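/- For integers $n,k\ge 1$ put $H_n=\sum_{j=1}^n \frac1j$, $\zeta_n(k)=\sum_{j=1}^n\frac1{j^k}$ and $L_n(k)=\sum_{j=1}^n\frac{(-1)^{j-1}}{j^k}$. Let $\zeta$ be the Riemann zeta function and $\mathrm{Li}_4(\tfrac12)=\sum_{n\ge1}\frac{1}{2^n n^4}$. In the identities below, the two series with denominator $n$ converge (in the sense of partial sums in the natural order), all the other series converge absolutely, and the following hold: $$\sum_{n=1}^\infty \frac{L_n(1)\zeta_n(3)}{n^2}+\sum_{n=1}^\infty \frac{L_n(1)\zeta_n(2)}{n^3}=\tfrac34\zeta(3)^2+\tfrac74\zeta(6)+\tfrac58\zeta(2)\zeta(3)\ln2-2\zeta(2)\mathrm{Li}_4(\tfrac12)+\tfrac54\zeta(4)\ln^22-\tfrac1{12}\zeta(2)\ln^42;$$ $$\sum_{n=1}^\infty \frac{\zeta_n(2)\zeta_n(3)}{n}(-1)^{n-1}=-\tfrac{161}{64}\zeta(6)+\tfrac{31}{16}\zeta(5)\ln2+\tfrac9{32}\zeta(3)^2+\tfrac38\zeta(2)\zeta(3)\ln2+2\zeta(2)\mathrm{Li}_4(\tfrac12)-\tfrac54\zeta(4)\ln^22+\tfrac1{12}\zeta(2)\ln^42+\sum_{n=1}^\infty\frac{\zeta_n(2)}{n^4}(-1)^{n-1}-\sum_{n=1}^\infty\frac{L_n(3)}{n^3};$$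 $$\sum_{n=1}^\infty \frac{L_n(1)L_n(3)}{n^2}(-1)^{n-1}+\sum_{n=1}^\infty \frac{L_n(1)L_n(2)}{n^3}(-1)^{n-1}=-\tfrac{385}{128}\zeta(6)+\tfrac{31}{8}\zeta(5)\ln2+\tfrac3{32}\zeta(3)^2+\tfrac98\zeta(2)\zeta(3)\ln2+\zeta(2)\mathrm{Li}_4(\tfrac12)-\tfrac58\zeta(4)\ln^22+\tfrac1{24}\zeta(2)\ln^42;$$ $$\sum_{n=1}^\infty \frac{L_n(2)L_n(3)}{n}(-1)^{n-1}=\tfrac{163}{128}\zeta(6)-\tfrac{31}{16}\zeta(5)\ln2+\tfrac3{16}\zeta(3)^2-\tfrac34\zeta(2)\zeta(3)\ln2-\zeta(2)\mathrm{Li}_4(\tfrac12)+\tfrac58\zeta(4)\ln^22-\tfrac1{24}\zeta(2)\ln^42+\sum_{n=1}^\infty\frac{L_n(2)}{n^4}+\sum_{n=1}^\infty\frac{L_n(3)}{n^3};$$ $$\sum_{n=1}^\infty \frac{L_n(1)\zeta_n(3)}{n^2}=\tfrac{2079}{128}\zeta(6)+\tfrac{93}{32}\zeta(5)\ln2-\tfrac5{16}\zeta(3)^2-3\zeta(2)\zeta(3)\ln2-2\zeta(2)\mathrm{Li}_4(\tfrac12)+\tfrac54\zeta(4)\ln^22-\tfrac1{12}\zeta(2)\ln^42+\sum_{n=1}^\infty\frac{L_n(1)}{n^5}(-1)^{n-1}-\sum_{n=1}^\infty\frac{L_n(2)}{n^4}-4\sum_{n=1}^\infty\frac{\zeta_n(2)}{n^4}(-1)^{n-1}-8\sum_{n=1}^\infty\frac{H_n}{n^5}(-1)^{n-1}.$$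 -/

import Mathlib

open Filter Topology

noncomputable section

namespace EulerSum

/-- The generalized harmonic number `ζ_n(k) = ∑_{j=1}^n 1 / j^k`. -/
def zetaN (n k : ℕ) : ℝ := ∑ j ∈ Finset.Icc 1 n, 1 / (j : ℝ) ^ k

/-- The alternating harmonic number `L_n(k) = ∑_{j=1}^n (-1)^(j-1) / j^k`. -/
def altN (n k : ℕ) : ℝ := ∑ j ∈ Finset.Icc 1 n, (-1 : ℝ) ^ (j - 1) / (j : ℝ) ^ k

/-- The real number `ζ(k)` for a natural number `k ≥ 2`. -/
def zetaVal (k : ℕ) : ℝ := (riemannZeta (k : ℂ)).re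

/-- The polylogarithm `Li_p(x) = ∑_{n ≥ 1} x^n / n^p` (used only at `p = 4`, `x = 1/2`). -/
def polylog (p : ℕ) (x : ℝ) : ℝ := ∑' n : ℕ, x ^ (n + 1) / ((n : ℝ) + 1) ^ p

/-- The sum `∑_{n ≥ 1} f n` of an absolutely convergent series. -/
def absSum (f : ℕ → ℝ) : ℝ := ∑' n : ℕ, f (n + 1)

/-- The series `∑_{n ≥ 1} f n` converges absolutely. -/
def AbsConv (f : ℕ → ℝ) : Prop := Summable fun n : ℕ => |f (n + 1)|

/-- The series `∑_{n ≥ 1} f n` converges (possibly conditionally), in the sense of partial sums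
taken in the natural order, and its sum is `s`. -/
def SumsTo (f : ℕ → ℝ) (s : ℝ) : Prop :=
  Tendsto (fun N : ℕ => ∑ n ∈ Finset.Icc 1 N, f n) atTop (𝓝 s)

theorem zetaVal_eq_tsum {k : ℕ} (hk : 2 ≤ k) :
    zetaVal k = ∑' n : ℕ, 1 / (n : ℝ) ^ k := by
  have h := zeta_nat_eq_tsum_of_gt_one (k := k) (by omega)
  have h2 : riemannZeta (k : ℂ) = ((∑' n : ℕ, 1 / (n : ℝ) ^ k : ℝ) : ℂ) := by
    rw [h]; push_cast; rfl
  rw [zetaVal, h2, Complex.ofReal_re]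

end EulerSum

end

noncomputable section

namespace EulerSum

open Finset PowerSeries

/-! Multiplying out the partial sums turns every series in the statement into a combination of
alternating multiple zeta values `mzv s`, limits of strictly nested sums over signed exponents, a
negative exponent carrying the factor `(-1)^n`. In this normalisation `ln 2 = -mzv [-1]` and `L_n(k)
= -nestedSum [-k] n`. The five identities become linear relations between weight-six values and
products of values of lower weight, and these relations follow from the double shuffle relations
together with a few explicit evaluations.

The stuffle product (`nestedSum_mul`) already holds for finite sums: the indices of two nested sums
are interleaved or merged. The shuffle product (`wordSeries_mul`) reflects the multiplication of
iterated integrals; it is proved for formal power series from the Leibniz rule for `t d/dt`,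
evaluated at `|t| < 1` (`nestedFun_mul`), and carried to `t = 1` by Abel's theorem
(`tendsto_nestedFun`). For the divergent factor `[1]` both products still make sense after removal
of the single divergent term, and the two remainders have the same limit
(`regularized_double_shuffle`).

The other inputs are the distribution relation, which gives `mzv [-k]` from `ζ(k)`; Euler's values
of `ζ(2)`, `ζ(4)`, `ζ(6)`; and the substitution `t ↦ t / (1 + t)`, which writes `Li_4(1/2)` as a sum
of alternating nested sums (`polylog_four_half`). What remains is linear algebra over the rationals,
recorded as explicit certificates in `eulerSum_weight_six`.

All convergence rests on the crude growth bound `nestedSum s n = O(√n)`, used in place of powers of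
logarithms. -/

/-! ### Strictly nested sums and the stuffle product -/

/-- The summand `sign(k)^n / n^|k|` attached to a signed exponent `k`. -/
def signedTerm (k : ℤ) (n : ℕ) : ℝ := (k.sign : ℝ) ^ n / (n : ℝ) ^ k.natAbs

/-- The nested sum over `N ≥ n₁ > n₂ > ⋯ ≥ 1` of the products of the `signedTerm k_i n_i`. -/
def nestedSum : List ℤ → ℕ → ℝ
  | [], _ => 1
  | k :: s, N => ∑ n ∈ range N, signedTerm k (n + 1) * nestedSum s n

/-- The part of the nested sum with largest summation index equal to `n`. -/
def nestedCoeff : List ℤ → ℕ → ℝ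
  | [], n => if n = 0 then 1 else 0
  | _ :: _, 0 => 0
  | k :: s, n + 1 => signedTerm k (n + 1) * nestedSum s n

/-- Identifies the nested sums as the partial sums at `t = 1` of the power series with these
coefficients, the form in which Abel's theorem applies. -/
theorem sum_nestedCoeff (s : List ℤ) (N : ℕ) :
    ∑ n ∈ range (N + 1), nestedCoeff s n = nestedSum s N := by
  cases s with
  | nil => simp [nestedCoeff, nestedSum]
  | cons k s => rw [sum_range_succ']; simp [nestedCoeff, nestedSum]

theorem nestedSum_cons_succ (k : ℤ) (s : List ℤ) (N : ℕ) :
    nestedSum (k :: s) (N + 1) =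
      nestedSum (k :: s) N + signedTerm k (N + 1) * nestedSum s N := by
  simp [nestedSum, sum_range_succ]

/-- The signed exponent of a product of two signed terms. -/
def mergeExp (a b : ℤ) : ℤ := a.sign * b.sign * (a.natAbs + b.natAbs : ℕ)

theorem signedTerm_mul (a b : ℤ) (n : ℕ) :
    signedTerm a (n + 1) * signedTerm b (n + 1) = signedTerm (mergeExp a b) (n + 1) := by
  rcases eq_or_ne a 0 with rfl | ha
  · simp [signedTerm, mergeExp]
  rcases eq_or_ne b 0 with rfl | hb
  · simp [signedTerm, mergeExp]
  have h1 : (mergeExp a b).sign = a.sign * b.sign := by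
    have : ((a.natAbs + b.natAbs : ℕ) : ℤ).sign = 1 := by
      apply Int.sign_eq_one_of_pos; omega
    simp only [mergeExp, Int.sign_mul, this, Int.sign_sign, mul_one]
  have h2 : (mergeExp a b).natAbs = a.natAbs + b.natAbs := by
    simp only [mergeExp, Int.natAbs_mul, Int.natAbs_sign_of_ne_zero ha,
      Int.natAbs_sign_of_ne_zero hb, one_mul, Int.natAbs_natCast]
  rw [signedTerm, signedTerm, signedTerm, h1, h2]
  push_cast
  rw [mul_pow, pow_add ((n : ℝ) + 1), div_mul_div_comm]

/-- The quasi-shuffle products of `a :: u` with the suffixes of a composition, given those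
of `u`. -/
def stuffleCons (a : ℤ) (u : List ℤ) (f : List ℤ → List (List ℤ)) : List ℤ → List (List ℤ)
  | [] => [a :: u]
  | b :: v =>
    (f (b :: v)).map (List.cons a) ++ (stuffleCons a u f v).map (List.cons b) ++
      (f v).map (List.cons (mergeExp a b))

/-- The quasi-shuffle product of two signed compositions, as a list of compositions. -/
def stuffle : List ℤ → List ℤ → List (List ℤ)
  | [] => fun v => [v]
  | a :: u => stuffleCons a u (stuffle u)

/-- Nesting two structural recursions, rather than recursing on the total length, makes this a
definitional equality and lets `decide` evaluate concrete products. -/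
theorem stuffle_cons_cons (a b : ℤ) (u v : List ℤ) : stuffle (a :: u) (b :: v) =
    (stuffle u (b :: v)).map (List.cons a) ++ (stuffle (a :: u) v).map (List.cons b) ++
      (stuffle u v).map (List.cons (mergeExp a b)) := rfl

theorem sum_map_cons_nestedSum_succ (k : ℤ) (l : List (List ℤ)) (N : ℕ) :
    ((l.map (List.cons k)).map fun s => nestedSum s (N + 1)).sum =
      ((l.map (List.cons k)).map fun s => nestedSum s N).sum +
        signedTerm k (N + 1) * (l.map fun s => nestedSum s N).sum := by
  induction l with
  | nil => simp
  | cons s l ih =>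
    simp only [List.map_cons, List.sum_cons, ih, nestedSum_cons_succ]
    ring

theorem sum_map_cons_nestedSum_zero (k : ℤ) (l : List (List ℤ)) :
    ((l.map (List.cons k)).map fun s => nestedSum s 0).sum = 0 := by
  induction l with
  | nil => simp
  | cons s l ih => simp only [List.map_cons, List.sum_cons, ih]; simp [nestedSum]

/-- In passing from `N` to `N + 1` the new terms are those in which the index `N + 1` is used by the
first factor, by the second, or by both; these are the three branches of the stuffle recursion. -/
theorem nestedSum_mul (u v : List ℤ) (N : ℕ) :
    nestedSum u N * nestedSum v N = ((stuffle u v).map fun s => nestedSum s N).sum := by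
  induction N generalizing u v with
  | zero =>
    rcases u with _ | ⟨a, u⟩
    · simp [stuffle, nestedSum]
    rcases v with _ | ⟨b, v⟩
    · simp [stuffle, stuffleCons, nestedSum]
    rw [stuffle_cons_cons, List.map_append, List.map_append, List.sum_append, List.sum_append]
    simp only [sum_map_cons_nestedSum_zero]
    simp [nestedSum]
  | succ N ih =>
    rcases u with _ | ⟨a, u⟩
    · simp [stuffle, nestedSum]
    rcases v with _ | ⟨b, v⟩
    · simp [stuffle, stuffleCons, nestedSum]
    have h := ih (a :: u) (b :: v)
    rw [stuffle_cons_cons, List.map_append, List.map_append, List.sum_append, List.sum_append] at h ⊢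
    simp only [sum_map_cons_nestedSum_succ, ← ih, ← signedTerm_mul, nestedSum_cons_succ]
    linear_combination h

/-! ### Words and the shuffle product -/

/-- The power series of `t / (1 - a t) * a`, or `1` for the letter `a = 0`. -/
def letterSeries (a : ℤ) : ℝ⟦X⟧ :=
  if a = 0 then 1 else PowerSeries.mk fun n => if n = 0 then 0 else (a : ℝ) ^ n

/-- The power series of the iterated integral attached to a word in letters `0, 1, -1`. -/
def wordSeries : List ℤ → ℝ⟦X⟧
  | [] => 1
  | a :: w => PowerSeries.mk fun n => coeff n (letterSeries a * wordSeries w) / n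

/-- A word whose last letter is not `0`. -/
def Proper : List ℤ → Prop
  | [] => True
  | a :: w => (a ≠ 0 ∨ w ≠ []) ∧ Proper w

theorem constantCoeff_wordSeries_cons (a : ℤ) (w : List ℤ) :
    constantCoeff (wordSeries (a :: w)) = 0 := by
  rw [← coeff_zero_eq_constantCoeff_apply, wordSeries, coeff_mk]
  simp

/-- Division by `n` inverts `t d/dt` once the constant term vanishes. The hypothesis excludes the
word `[0]`, which stands for the divergent integral of `dt / t`: there the coefficient `1 / 0`
defaults to `0` and the equation fails. -/
theorem X_mul_derivative_wordSeries {a : ℤ} {w : List ℤ} (h : a ≠ 0 ∨ w ≠ []) :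
    X * d⁄dX ℝ (wordSeries (a :: w)) = letterSeries a * wordSeries w := by
  ext n
  cases n with
  | zero =>
    rw [coeff_zero_X_mul, coeff_zero_eq_constantCoeff_apply, map_mul]
    rcases h with h | h
    · have : constantCoeff (letterSeries a) = 0 := by
        rw [← coeff_zero_eq_constantCoeff_apply, letterSeries, if_neg h, coeff_mk]
        simp
      rw [this, zero_mul]
    · obtain ⟨b, w, rfl⟩ := List.exists_cons_of_ne_nil h
      rw [constantCoeff_wordSeries_cons, mul_zero]
  | succ n =>
    rw [coeff_succ_X_mul, coeff_derivative, wordSeries, coeff_mk]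
    push_cast
    have : (n : ℝ) + 1 ≠ 0 := by positivity
    field_simp

theorem eq_of_X_mul_derivative_eq {f g : ℝ⟦X⟧} (h : X * d⁄dX ℝ f = X * d⁄dX ℝ g)
    (h0 : constantCoeff f = constantCoeff g) : f = g := by
  apply derivative.ext _ h0
  ext n
  have := congrArg (coeff (n + 1)) h
  rwa [coeff_succ_X_mul, coeff_succ_X_mul] at this

/-- The shuffle products of `a :: u` with the suffixes of a word, given those of `u`. -/
def shuffleCons (a : ℤ) (u : List ℤ) (f : List ℤ → List (List ℤ)) : List ℤ → List (List ℤ)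
  | [] => [a :: u]
  | b :: v => (f (b :: v)).map (List.cons a) ++ (shuffleCons a u f v).map (List.cons b)

/-- The shuffle product of two words, as a list of words. -/
def shuffle : List ℤ → List ℤ → List (List ℤ)
  | [] => fun v => [v]
  | a :: u => shuffleCons a u (shuffle u)

theorem shuffle_cons_cons (a b : ℤ) (u v : List ℤ) : shuffle (a :: u) (b :: v) =
    (shuffle u (b :: v)).map (List.cons a) ++ (shuffle (a :: u) v).map (List.cons b) := rfl

theorem ne_nil_of_mem_shuffle {u v x : List ℤ} (h : x ∈ shuffle u v) (huv : u ≠ [] ∨ v ≠ []) :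
    x ≠ [] := by
  rcases u with _ | ⟨a, u⟩
  · simp_all [shuffle]
  rcases v with _ | ⟨b, v⟩
  · simp_all [shuffle, shuffleCons]
  rw [shuffle_cons_cons, List.mem_append, List.mem_map, List.mem_map] at h
  rcases h with ⟨y, -, rfl⟩ | ⟨y, -, rfl⟩ <;> simp

theorem X_mul_derivative_sum_map_cons {a : ℤ} {l : List (List ℤ)} (h : ∀ x ∈ l, x ≠ []) :
    X * d⁄dX ℝ ((l.map (List.cons a)).map wordSeries).sum =
      letterSeries a * (l.map wordSeries).sum := by
  induction l with
  | nil => simp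
  | cons x l ih =>
    simp only [List.map_cons, List.sum_cons, map_add, mul_add]
    rw [X_mul_derivative_wordSeries (.inr (h x (by simp))),
      ih fun y hy => h y (by simp [hy])]

theorem constantCoeff_sum_map_cons (a : ℤ) (l : List (List ℤ)) :
    constantCoeff ((l.map (List.cons a)).map wordSeries).sum = 0 := by
  induction l with
  | nil => simp
  | cons x l ih =>
    simp only [List.map_cons, List.sum_cons, map_add, ih, constantCoeff_wordSeries_cons, add_zero]

/-- By Leibniz, `t d/dt` of the product strips the first letter of one factor or of the other,
exactly as the shuffle recursion does. By induction both sides have the same derivative, and both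
constant terms vanish. -/
theorem wordSeries_mul (u v : List ℤ) (hu : Proper u) (hv : Proper v) :
    wordSeries u * wordSeries v = ((shuffle u v).map wordSeries).sum := by
  induction u generalizing v with
  | nil => simp [shuffle, wordSeries]
  | cons a u ihu =>
  induction v with
  | nil => simp [shuffle, shuffleCons, wordSeries]
  | cons b v ihv =>
    have h1 := ihu (b :: v) hu.2 hv
    have h2 := ihv hv.2
    rw [shuffle_cons_cons, List.map_append, List.sum_append]
    apply eq_of_X_mul_derivative_eq
    · rw [map_add, mul_add, X_mul_derivative_sum_map_cons, X_mul_derivative_sum_map_cons,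
        ← h1, ← h2, Derivation.leibniz, smul_eq_mul, smul_eq_mul]
      · have e1 := X_mul_derivative_wordSeries hu.1
        have e2 := X_mul_derivative_wordSeries hv.1
        linear_combination wordSeries (b :: v) * e1 + wordSeries (a :: u) * e2
      · exact fun x hx => ne_nil_of_mem_shuffle hx (.inl (by simp))
      · exact fun x hx => ne_nil_of_mem_shuffle hx (.inr (by simp))
    · rw [map_mul, map_add, constantCoeff_sum_map_cons, constantCoeff_sum_map_cons,
        constantCoeff_wordSeries_cons, zero_mul, add_zero]

/-- The word of a signed composition, with running sign `e`. -/
def toWordAux (e : ℤ) : List ℤ → List ℤ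
  | [] => []
  | k :: s => List.replicate (k.natAbs - 1) 0 ++ (e * k.sign) :: toWordAux (e * k.sign) s

/-- The word of a signed composition. -/
abbrev toWord (s : List ℤ) : List ℤ := toWordAux 1 s

theorem proper_append_cons (m : ℕ) {a : ℤ} {w : List ℤ} (ha : a ≠ 0) (hw : Proper w) :
    Proper (List.replicate m 0 ++ a :: w) := by
  induction m with
  | zero => exact ⟨.inl ha, hw⟩
  | succ m ih => exact ⟨.inr (by simp), ih⟩

theorem proper_toWordAux {e : ℤ} {s : List ℤ} (he : e ≠ 0) (hs : ∀ k ∈ s, k ≠ 0) :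
    Proper (toWordAux e s) := by
  induction s generalizing e with
  | nil => trivial
  | cons k s ih =>
    have h : e * k.sign ≠ 0 :=
      mul_ne_zero he (by simpa [Int.sign_eq_zero_iff_zero] using hs k (by simp))
    exact proper_append_cons _ h (ih h fun j hj => hs j (by simp [hj]))

theorem coeff_wordSeries_replicate (m : ℕ) (w : List ℤ) (n : ℕ) :
    coeff (n + 1) (wordSeries (List.replicate m 0 ++ w)) =
      coeff (n + 1) (wordSeries w) / ((n + 1 : ℕ) : ℝ) ^ m := by
  induction m with
  | zero => simp
  | succ m ih =>
    rw [List.replicate_succ, List.cons_append, wordSeries, coeff_mk, letterSeries, if_pos rfl,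
      one_mul, ih, div_div, pow_succ]

theorem coeff_letterSeries_mul {a : ℤ} (ha : a ≠ 0) (f : ℝ⟦X⟧) (n : ℕ) :
    coeff (n + 1) (letterSeries a * f) =
      ∑ i ∈ range (n + 1), coeff i f * (a : ℝ) ^ (n + 1 - i) := by
  rw [mul_comm, coeff_mul, Finset.Nat.sum_antidiagonal_eq_sum_range_succ_mk, sum_range_succ]
  simp only [letterSeries, if_neg ha, coeff_mk]
  simp only [Nat.sub_self, if_true, mul_zero, add_zero]
  refine sum_congr rfl fun i hi => ?_
  rw [if_neg]
  have := mem_range.1 hi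
  omega

/-- The letters are running products of signs because multiplication by the series of a letter `a`
is convolution with `a^(n-i)`. If the inner coefficients carry `a^i`, the powers combine to `a^n`
and the convolution is a plain partial sum. -/
theorem coeff_wordSeries_toWordAux {e : ℤ} {s : List ℤ} (he : e ^ 2 = 1)
    (hs : ∀ k ∈ s, k ≠ 0) (n : ℕ) :
    coeff n (wordSeries (toWordAux e s)) = (e : ℝ) ^ n * nestedCoeff s n := by
  induction s generalizing e n with
  | nil =>
    cases n <;> simp [toWordAux, wordSeries, nestedCoeff, coeff_one]
  | cons k s ih =>
    have hk : k ≠ 0 := hs k (by simp)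
    have hsg : k.sign ^ 2 = 1 := by
      rcases lt_or_gt_of_ne hk with h | h
      · rw [Int.sign_eq_neg_one_of_neg h]; norm_num
      · rw [Int.sign_eq_one_of_pos h]; norm_num
    have he' : (e * k.sign) ^ 2 = 1 := by rw [mul_pow, he, hsg, one_mul]
    have hne : e * k.sign ≠ 0 := fun h => by simp [h] at he'
    cases n with
    | zero =>
      rw [toWordAux]
      rcases h : List.replicate (k.natAbs - 1) 0 ++ (e * k.sign) :: toWordAux (e * k.sign) s with
        _ | ⟨b, w⟩
      · simp at h
      · rw [coeff_zero_eq_constantCoeff_apply, constantCoeff_wordSeries_cons]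
        simp [nestedCoeff]
    | succ n =>
      rw [toWordAux, coeff_wordSeries_replicate, wordSeries, coeff_mk,
        coeff_letterSeries_mul hne]
      have h1 : ∀ i ∈ range (n + 1),
          coeff i (wordSeries (toWordAux (e * k.sign) s)) *
            ((e * k.sign : ℤ) : ℝ) ^ (n + 1 - i) =
          ((e * k.sign : ℤ) : ℝ) ^ (n + 1) * nestedCoeff s i := by
        intro i hi
        rw [ih he' fun j hj => hs j (by simp [hj])]
        have : n + 1 = i + (n + 1 - i) := by have := mem_range.1 hi; omega
        conv_rhs => rw [this, pow_add]
        ring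
      rw [sum_congr rfl h1, ← mul_sum, sum_nestedCoeff, nestedCoeff, signedTerm]
      have h2 : k.natAbs = k.natAbs - 1 + 1 := by omega
      conv_rhs => rw [h2, pow_succ]
      have : ((n + 1 : ℕ) : ℝ) ≠ 0 := by positivity
      push_cast
      rw [mul_pow]
      field_simp
      ring

theorem coeff_wordSeries_toWord {s : List ℤ} (hs : ∀ k ∈ s, k ≠ 0) (n : ℕ) :
    coeff n (wordSeries (toWord s)) = nestedCoeff s n := by
  rw [coeff_wordSeries_toWordAux (by norm_num) hs]
  simp

/-! ### Growth and convergence of nested sums -/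

theorem abs_signedTerm_le (k : ℤ) (n : ℕ) :
    |signedTerm k (n + 1)| ≤ 1 / ((n : ℝ) + 1) ^ k.natAbs := by
  have h : |((k.sign : ℤ) : ℝ)| ≤ 1 := by
    rcases lt_trichotomy k 0 with h | rfl | h
    · simp [Int.sign_eq_neg_one_of_neg h]
    · simp
    · simp [Int.sign_eq_one_of_pos h]
  rw [signedTerm, abs_div, abs_pow, abs_pow, Nat.cast_succ,
    abs_of_pos (by positivity : (0 : ℝ) < n + 1)]
  gcongr
  exact pow_le_one₀ (abs_nonneg _) h

theorem abs_signedTerm_le_inv {k : ℤ} {m : ℕ} (hk : m ≤ k.natAbs) (n : ℕ) :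
    |signedTerm k (n + 1)| ≤ 1 / ((n : ℝ) + 1) ^ m := by
  refine (abs_signedTerm_le k n).trans ?_
  have : (1 : ℝ) ≤ n + 1 := by linarith [n.cast_nonneg (α := ℝ)]
  gcongr

theorem sum_inv_sqrt_le (n : ℕ) : ∑ m ∈ range n, 1 / √((m : ℝ) + 1) ≤ 2 * √n := by
  induction n with
  | zero => simp
  | succ n ih =>
    rw [sum_range_succ]
    have ha : 0 ≤ √(n : ℝ) := Real.sqrt_nonneg _
    have hb : 0 < √((n : ℝ) + 1) := Real.sqrt_pos.2 (by positivity)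
    have ha2 : √(n : ℝ) ^ 2 = n := Real.sq_sqrt (by positivity)
    have hb2 : √((n : ℝ) + 1) ^ 2 = n + 1 := Real.sq_sqrt (by positivity)
    have h : 1 / √((n : ℝ) + 1) ≤ 2 * √((n : ℝ) + 1) - 2 * √n := by
      rw [div_le_iff₀ hb]
      nlinarith [sq_nonneg (√((n : ℝ) + 1) - √n)]
    push_cast
    linarith

/-- An inner sum of size `√m` divided by `m` leaves `1/√m`, which sums to at most `2√n`; each
further exponent therefore costs only a factor `2`. -/
theorem abs_nestedSum_le {s : List ℤ} (hs : ∀ k ∈ s, k ≠ 0) (n : ℕ) :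
    |nestedSum s n| ≤ 2 ^ s.length * √((n : ℝ) + 1) := by
  induction s generalizing n with
  | nil =>
    simp only [nestedSum, List.length_nil, pow_zero, one_mul, abs_one]
    exact Real.one_le_sqrt.2 (by linarith [n.cast_nonneg (α := ℝ)])
  | cons k s ih =>
    have hk : 1 ≤ k.natAbs := by have := hs k (by simp); omega
    calc |nestedSum (k :: s) n|
        ≤ ∑ m ∈ range n, |signedTerm k (m + 1) * nestedSum s m| := abs_sum_le_sum_abs _ _
      _ ≤ ∑ m ∈ range n, 2 ^ s.length * (1 / √((m : ℝ) + 1)) := by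
        refine sum_le_sum fun m _ => ?_
        have h1 := abs_signedTerm_le_inv hk m
        have h2 := ih (fun j hj => hs j (by simp [hj])) m
        have hp : (0 : ℝ) < (m : ℝ) + 1 := by positivity
        rw [abs_mul]
        calc _ ≤ 1 / ((m : ℝ) + 1) ^ 1 * (2 ^ s.length * √((m : ℝ) + 1)) :=
              mul_le_mul h1 h2 (abs_nonneg _) (by positivity)
          _ = 2 ^ s.length * (1 / √((m : ℝ) + 1)) := by
              have := Real.sq_sqrt hp.le
              have h0 : √((m : ℝ) + 1) ≠ 0 := (Real.sqrt_pos.2 hp).ne'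
              field_simp
              linarith
      _ ≤ 2 ^ s.length * (2 * √n) := by
        rw [← mul_sum]
        exact mul_le_mul_of_nonneg_left (sum_inv_sqrt_le n) (by positivity)
      _ ≤ 2 ^ (k :: s).length * √((n : ℝ) + 1) := by
        rw [List.length_cons, pow_succ, mul_assoc]
        gcongr
        linarith

/-- With `a = √(m+1)` and `b = √(m+2)` one has `1/a - 1/b = 1/(ab(a+b))` and `b² ≤ 2a²`, so `6` is a
comfortable constant. The telescoping majorant gives both summability and a tail bound of order
`1/√n`. -/
theorem inv_mul_sqrt_le (m : ℕ) :
    1 / (((m : ℝ) + 1) * √((m : ℝ) + 1)) ≤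
      6 * (1 / √((m : ℝ) + 1) - 1 / √((m : ℝ) + 2)) := by
  have ha : 0 < √((m : ℝ) + 1) := Real.sqrt_pos.2 (by positivity)
  have hb : 0 < √((m : ℝ) + 2) := Real.sqrt_pos.2 (by positivity)
  have ha2 : √((m : ℝ) + 1) ^ 2 = m + 1 := Real.sq_sqrt (by positivity)
  have hb2 : √((m : ℝ) + 2) ^ 2 = m + 2 := Real.sq_sqrt (by positivity)
  have hm : (0 : ℝ) ≤ m := m.cast_nonneg
  generalize √((m : ℝ) + 1) = a at *
  generalize √((m : ℝ) + 2) = b at *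
  have h1 : (m : ℝ) + 1 = a ^ 2 := ha2.symm
  have h2 : (b - a) * (b + a) = 1 := by nlinarith
  have h3 : b - a = 1 / (b + a) := by field_simp; linarith
  have h4 : 6 * (1 / a - 1 / b) = 6 / (a * b * (b + a)) := by
    rw [div_sub_div _ _ ha.ne' hb.ne', one_mul, mul_one, h3]
    field_simp
  rw [h1, h4, div_le_div_iff₀ (by positivity) (by positivity)]
  nlinarith [mul_pos ha hb, sq_nonneg (a - b)]

theorem summable_inv_mul_sqrt : Summable fun m : ℕ => 1 / (((m : ℝ) + 1) * √((m : ℝ) + 1)) := by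
  refine summable_of_sum_range_le (c := 6) (fun m => by positivity) fun n => ?_
  refine (sum_le_sum fun m _ => inv_mul_sqrt_le m).trans ?_
  rw [← mul_sum]
  have h : ∀ m : ℕ, 1 / √((m : ℝ) + 1) - 1 / √((m : ℝ) + 2) =
      (fun i : ℕ => 1 / √((i : ℝ) + 1)) m - (fun i : ℕ => 1 / √((i : ℝ) + 1)) (m + 1) := by
    intro m
    have : (m : ℝ) + 2 = ((m + 1 : ℕ) : ℝ) + 1 := by push_cast; ring
    simp only [this]
  simp only [h, sum_range_sub']
  have : 0 ≤ 1 / √((n : ℝ) + 1) := by positivity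
  norm_num

/-- A bound for the terms of a nested sum whose leading exponent is at least two. -/
theorem abs_nestedCoeff_le {k : ℤ} {s : List ℤ} (hk : 2 ≤ k.natAbs) (hs : ∀ j ∈ s, j ≠ 0)
    (n : ℕ) : |signedTerm k (n + 1) * nestedSum s n| ≤
      2 ^ s.length * (1 / (((n : ℝ) + 1) * √((n : ℝ) + 1))) := by
  have hp : (0 : ℝ) < (n : ℝ) + 1 := by positivity
  rw [abs_mul]
  calc _ ≤ 1 / ((n : ℝ) + 1) ^ 2 * (2 ^ s.length * √((n : ℝ) + 1)) :=
        mul_le_mul (abs_signedTerm_le_inv hk n) (abs_nestedSum_le hs n) (abs_nonneg _)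
          (by positivity)
    _ = _ := by
        have := Real.sq_sqrt hp.le
        have h0 : √((n : ℝ) + 1) ≠ 0 := (Real.sqrt_pos.2 hp).ne'
        field_simp
        linarith

theorem summable_nestedCoeff {k : ℤ} {s : List ℤ} (hk : 2 ≤ k.natAbs) (hs : ∀ j ∈ s, j ≠ 0) :
    Summable fun n => signedTerm k (n + 1) * nestedSum s n :=
  .of_abs <| .of_nonneg_of_le (fun _ => abs_nonneg _) (abs_nestedCoeff_le hk hs)
    (summable_inv_mul_sqrt.mul_left _)

/-- Exponents for which the nested sum converges. -/
def Admissible (s : List ℤ) : Prop := (∀ k ∈ s, k ≠ 0) ∧ s.head? ≠ some 1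

instance (s : List ℤ) : Decidable (Admissible s) := by unfold Admissible; infer_instance

/-- The value of a convergent nested sum. -/
def mzv (s : List ℤ) : ℝ := limUnder atTop (nestedSum s)

/-- Summation by parts: averaging consecutive terms replaces `b` by its differences. -/
theorem two_mul_sum_alternating (b : ℕ → ℝ) (n : ℕ) :
    2 * ∑ m ∈ range (n + 1), (-1) ^ m * b m =
      b 0 + (-1) ^ n * b n + ∑ m ∈ range n, (-1) ^ m * (b m - b (m + 1)) := by
  induction n with
  | zero => simp; ring
  | succ n ih =>
    rw [sum_range_succ, mul_add, ih, sum_range_succ _ n, pow_succ]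
    ring

theorem exists_tendsto_alternating {b : ℕ → ℝ} (h0 : Tendsto b atTop (𝓝 0))
    (hb : Summable fun m => |b m - b (m + 1)|) :
    ∃ l, Tendsto (fun n => ∑ m ∈ range n, (-1) ^ m * b m) atTop (𝓝 l) := by
  have hs : Summable fun m => (-1) ^ m * (b m - b (m + 1)) := by
    refine .of_abs (hb.congr fun m => ?_)
    simp [abs_mul]
  have h1 : Tendsto (fun n => (-1) ^ n * b n) atTop (𝓝 0) := by
    rw [tendsto_zero_iff_abs_tendsto_zero] at h0 ⊢
    refine h0.congr fun n => ?_
    simp [abs_mul]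
  refine ⟨(b 0 + 0 + ∑' m, (-1) ^ m * (b m - b (m + 1))) / 2, ?_⟩
  rw [← tendsto_add_atTop_iff_nat 1]
  refine (((tendsto_const_nhds.add h1).add hs.hasSum.tendsto_sum_nat).div_const 2).congr
    fun n => ?_
  rw [← two_mul_sum_alternating]
  ring

theorem tendsto_inv_sqrt : Tendsto (fun n : ℕ => 1 / √((n : ℝ) + 1)) atTop (𝓝 0) := by
  simp only [one_div]
  exact (Real.tendsto_sqrt_atTop.comp
    (tendsto_natCast_atTop_atTop.atTop_add tendsto_const_nhds)).inv_tendsto_atTop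

theorem exists_tendsto_nestedSum {s : List ℤ} (h : Admissible s) :
    ∃ l, Tendsto (nestedSum s) atTop (𝓝 l) := by
  obtain ⟨hs, h1⟩ := h
  rcases s with _ | ⟨k, s⟩
  · exact ⟨1, tendsto_const_nhds⟩
  have hs' : ∀ j ∈ s, j ≠ 0 := fun j hj => hs j (by simp [hj])
  by_cases hk : 2 ≤ k.natAbs
  · exact ⟨_, (summable_nestedCoeff hk hs').hasSum.tendsto_sum_nat⟩
  have hk1 : k = -1 := by
    have : k ≠ 0 := hs k (by simp)
    have : k ≠ 1 := by simpa using h1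
    omega
  subst hk1
  -- For leading exponent `-1` the series is alternating in form, `(-1)^m * b m`. Absolute
  -- convergence may fail, but `b` tends to `0` and has bounded variation.
  set b : ℕ → ℝ := fun m => -(nestedSum s m / ((m : ℝ) + 1)) with hb
  have hbound : ∀ m : ℕ, |nestedSum s m| / ((m : ℝ) + 1) ≤
      2 ^ s.length * (1 / √((m : ℝ) + 1)) := by
    intro m
    have hp : (0 : ℝ) < (m : ℝ) + 1 := by positivity
    have h0 : √((m : ℝ) + 1) ≠ 0 := (Real.sqrt_pos.2 hp).ne'
    rw [div_le_iff₀ hp]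
    refine (abs_nestedSum_le hs' m).trans_eq ?_
    have := Real.sq_sqrt hp.le
    field_simp
    linarith
  have hlim : Tendsto b atTop (𝓝 0) := by
    refine squeeze_zero_norm (fun m => ?_)
      (by simpa using tendsto_inv_sqrt.const_mul ((2 : ℝ) ^ s.length))
    rw [hb, norm_neg, norm_div, Real.norm_eq_abs, Real.norm_eq_abs,
      abs_of_pos (by positivity : (0 : ℝ) < (m : ℝ) + 1)]
    simpa using hbound m
  have hdiff : ∀ m, |nestedSum s (m + 1) - nestedSum s m| ≤
      2 ^ s.length * (1 / √((m : ℝ) + 1)) := by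
    intro m
    rcases s with _ | ⟨j, r⟩
    · simp [nestedSum]
    rw [nestedSum_cons_succ, add_sub_cancel_left, abs_mul]
    have hr : ∀ i ∈ r, i ≠ 0 := fun i hi => hs' i (by simp [hi])
    have hj : 1 ≤ j.natAbs := by have := hs' j (by simp); omega
    have hp : (0 : ℝ) < (m : ℝ) + 1 := by positivity
    have h0 : √((m : ℝ) + 1) ≠ 0 := (Real.sqrt_pos.2 hp).ne'
    calc _ ≤ 1 / ((m : ℝ) + 1) ^ 1 * (2 ^ r.length * √((m : ℝ) + 1)) :=
          mul_le_mul (abs_signedTerm_le_inv hj m) (abs_nestedSum_le hr m) (abs_nonneg _)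
            (by positivity)
      _ = 2 ^ r.length * (1 / √((m : ℝ) + 1)) := by
          have := Real.sq_sqrt hp.le
          field_simp
          linarith
      _ ≤ _ := by
          rw [List.length_cons]
          gcongr
          · norm_num
          · omega
  obtain ⟨l, hl⟩ := exists_tendsto_alternating hlim (b := b) (by
    refine .of_nonneg_of_le (fun _ => abs_nonneg _) (fun m => ?_)
      (summable_inv_mul_sqrt.mul_left (2 * 2 ^ s.length))
    have hp : (0 : ℝ) < (m : ℝ) + 1 := by positivity
    -- Either the nested sum or the denominator changes; both contributions are `O(m^(-3/2))`.
    have e : b m - b (m + 1) = (nestedSum s (m + 1) - nestedSum s m) / ((m : ℝ) + 2) -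
        nestedSum s m / ((m : ℝ) + 1) / ((m : ℝ) + 2) := by
      simp only [hb]
      push_cast
      have : (m : ℝ) + 1 + 1 = m + 2 := by ring
      rw [this]
      field_simp
      ring
    have h2 : (0 : ℝ) < (m : ℝ) + 2 := by positivity
    have e2 : |(nestedSum s (m + 1) - nestedSum s m) / ((m : ℝ) + 2)| ≤
        2 ^ s.length * (1 / √((m : ℝ) + 1)) / ((m : ℝ) + 1) := by
      rw [abs_div, abs_of_pos h2]
      have := hdiff m
      gcongr
      linarith
    have e3 : |nestedSum s m / ((m : ℝ) + 1) / ((m : ℝ) + 2)| ≤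
        2 ^ s.length * (1 / √((m : ℝ) + 1)) / ((m : ℝ) + 1) := by
      rw [abs_div, abs_div, abs_of_pos h2, abs_of_pos hp]
      have := hbound m
      gcongr
      linarith
    rw [e]
    refine (abs_sub _ _).trans ((add_le_add e2 e3).trans_eq ?_)
    field_simp
    ring)
  refine ⟨l, hl.congr fun n => ?_⟩
  rw [nestedSum]
  refine sum_congr rfl fun m _ => ?_
  simp only [hb, signedTerm]
  norm_num [pow_succ]
  ring

theorem tendsto_nestedSum {s : List ℤ} (h : Admissible s) :
    Tendsto (nestedSum s) atTop (𝓝 (mzv s)) :=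
  tendsto_nhds_limUnder (exists_tendsto_nestedSum h)

theorem tendsto_sum_map_nestedSum {l : List (List ℤ)} (h : ∀ s ∈ l, Admissible s) :
    Tendsto (fun N => (l.map fun s => nestedSum s N).sum) atTop
      (𝓝 (l.map mzv).sum) := by
  induction l with
  | nil => simp
  | cons s l ih =>
    simp only [List.map_cons, List.sum_cons]
    exact (tendsto_nestedSum (h s (by simp))).add (ih fun r hr => h r (by simp [hr]))

/-- The stuffle product of values of nested sums. -/
theorem mzv_mul_stuffle {u v : List ℤ} (hu : Admissible u) (hv : Admissible v)
    (h : ∀ s ∈ stuffle u v, Admissible s) :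
    mzv u * mzv v = ((stuffle u v).map mzv).sum := by
  refine tendsto_nhds_unique ((tendsto_nestedSum hu).mul (tendsto_nestedSum hv)) ?_
  refine (tendsto_sum_map_nestedSum h).congr fun N => ?_
  rw [nestedSum_mul]

/-! ### Generating functions and the shuffle product -/

/-- The multiple polylogarithm `∑ nestedCoeff s n * t ^ n`. -/
def nestedFun (s : List ℤ) (t : ℝ) : ℝ := ∑' n, nestedCoeff s n * t ^ n

theorem abs_nestedCoeff_le_two_pow {s : List ℤ} (hs : ∀ k ∈ s, k ≠ 0) (n : ℕ) :
    |nestedCoeff s n| ≤ 2 ^ s.length := by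
  rcases s with _ | ⟨k, s⟩
  · rw [nestedCoeff]
    split_ifs <;> simp
  rcases n with _ | n
  · simp [nestedCoeff]
  have hk : 1 ≤ k.natAbs := by have := hs k (by simp); omega
  have hp : (1 : ℝ) ≤ (n : ℝ) + 1 := by linarith [n.cast_nonneg (α := ℝ)]
  have hr : √((n : ℝ) + 1) ≤ (n : ℝ) + 1 := Real.sqrt_le_iff.2 ⟨by linarith, by nlinarith⟩
  rw [nestedCoeff, abs_mul]
  calc _ ≤ 1 / ((n : ℝ) + 1) ^ 1 * (2 ^ s.length * √((n : ℝ) + 1)) :=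
        mul_le_mul (abs_signedTerm_le_inv hk n)
          (abs_nestedSum_le (fun j hj => hs j (by simp [hj])) n) (abs_nonneg _) (by positivity)
    _ ≤ 1 / ((n : ℝ) + 1) ^ 1 * (2 ^ s.length * ((n : ℝ) + 1)) := by gcongr
    _ = 2 ^ s.length := by field_simp
    _ ≤ _ := by
      rw [List.length_cons]
      gcongr
      · norm_num
      · omega

theorem summable_norm_mul_pow {a : ℕ → ℝ} {C t : ℝ} (ha : ∀ n, |a n| ≤ C) (ht : |t| < 1) :
    Summable fun n => ‖a n * t ^ n‖ := by
  refine .of_nonneg_of_le (fun _ => norm_nonneg _) (fun n => ?_)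
    ((summable_geometric_of_lt_one (abs_nonneg t) ht).mul_left C)
  rw [norm_mul, norm_pow, Real.norm_eq_abs, Real.norm_eq_abs]
  exact mul_le_mul_of_nonneg_right (ha n) (by positivity)

theorem summable_nestedFun {s : List ℤ} (hs : ∀ k ∈ s, k ≠ 0) {t : ℝ} (ht : |t| < 1) :
    Summable fun n => ‖nestedCoeff s n * t ^ n‖ :=
  summable_norm_mul_pow (abs_nestedCoeff_le_two_pow hs) ht

/-- Abel's limit theorem, which also covers the conditionally convergent leading exponent `-1`. -/
theorem tendsto_nestedFun {s : List ℤ} (h : Admissible s) :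
    Tendsto (nestedFun s) (𝓝[<] 1) (𝓝 (mzv s)) := by
  refine Real.tendsto_tsum_powerSeries_nhdsWithin_lt ?_
  rw [← tendsto_add_atTop_iff_nat 1]
  simpa only [sum_nestedCoeff] using tendsto_nestedSum h

theorem hasSum_list_map {l : List (List ℤ)} (h : ∀ s ∈ l, ∀ k ∈ s, k ≠ 0) {t : ℝ}
    (ht : |t| < 1) : HasSum (fun n => (l.map fun s => nestedCoeff s n).sum * t ^ n)
      (l.map fun s => nestedFun s t).sum := by
  induction l with
  | nil => simp
  | cons s l ih =>
    simp only [List.map_cons, List.sum_cons, add_mul]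
    exact (summable_nestedFun (h s (by simp)) ht).of_norm.hasSum.add
      (ih fun r hr => h r (by simp [hr]))

/-- The formal shuffle identity evaluated through the Cauchy product. The hypothesis on words is a
finite list identity, decidable in concrete cases. -/
theorem nestedFun_mul {u v : List ℤ} {l : List (List ℤ)} (hu : ∀ k ∈ u, k ≠ 0)
    (hv : ∀ k ∈ v, k ≠ 0) (hl : ∀ s ∈ l, ∀ k ∈ s, k ≠ 0)
    (h : shuffle (toWord u) (toWord v) = l.map toWord) {t : ℝ} (ht : |t| < 1) :
    nestedFun u t * nestedFun v t = (l.map fun s => nestedFun s t).sum := by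
  rw [nestedFun, nestedFun, tsum_mul_tsum_eq_tsum_sum_antidiagonal_of_summable_norm
    (summable_nestedFun hu ht) (summable_nestedFun hv ht), ← (hasSum_list_map hl ht).tsum_eq]
  refine tsum_congr fun n => ?_
  have h1 := congrArg (PowerSeries.coeff n) (wordSeries_mul (toWord u) (toWord v)
    (proper_toWordAux one_ne_zero hu) (proper_toWordAux one_ne_zero hv))
  rw [PowerSeries.coeff_mul, h, map_list_sum, List.map_map, List.map_map] at h1
  have h2 : l.map (PowerSeries.coeff n ∘ wordSeries ∘ toWord) =
      l.map fun s => nestedCoeff s n :=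
    List.map_congr_left fun s hs => coeff_wordSeries_toWord (hl s hs) n
  rw [← h2, Function.comp_assoc] at *
  rw [← h1, sum_mul]
  refine sum_congr rfl fun p hp => ?_
  rw [coeff_wordSeries_toWord hu, coeff_wordSeries_toWord hv,
    ← Finset.HasAntidiagonal.mem_antidiagonal.1 hp, pow_add]
  ring

theorem tendsto_sum_map_nestedFun {l : List (List ℤ)} (h : ∀ s ∈ l, Admissible s) :
    Tendsto (fun t => (l.map fun s => nestedFun s t).sum) (𝓝[<] 1)
      (𝓝 (l.map mzv).sum) := by
  induction l with
  | nil => simp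
  | cons s l ih =>
    simp only [List.map_cons, List.sum_cons]
    exact (tendsto_nestedFun (h s (by simp))).add (ih fun r hr => h r (by simp [hr]))

theorem eventually_mem_Ioo : ∀ᶠ t : ℝ in 𝓝[<] 1, t ∈ Set.Ioo 0 1 :=
  Ioo_mem_nhdsLT zero_lt_one

theorem abs_lt_one_of_mem_Ioo {t : ℝ} (ht : t ∈ Set.Ioo (0 : ℝ) 1) : |t| < 1 := by
  rw [abs_of_pos ht.1]
  exact ht.2

/-- The shuffle product of values of nested sums. -/
theorem mzv_mul_shuffle {u v : List ℤ} {l : List (List ℤ)} (hu : Admissible u)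
    (hv : Admissible v) (hl : ∀ s ∈ l, Admissible s)
    (h : shuffle (toWord u) (toWord v) = l.map toWord) :
    mzv u * mzv v = (l.map mzv).sum := by
  refine tendsto_nhds_unique ((tendsto_nestedFun hu).mul (tendsto_nestedFun hv))
    ((tendsto_sum_map_nestedFun hl).congr' ?_)
  filter_upwards [eventually_mem_Ioo] with t ht
  exact (nestedFun_mul hu.1 hv.1 (fun s hs => (hl s hs).1) h (abs_lt_one_of_mem_Ioo ht)).symm

/-! ### The regularized double shuffle relation -/

theorem admissible_cons_of_two_le {k : ℤ} {s : List ℤ} (hk : 2 ≤ k.natAbs)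
    (hs : ∀ j ∈ s, j ≠ 0) : Admissible (k :: s) := by
  refine ⟨fun j hj => ?_, ?_⟩
  · rcases List.mem_cons.1 hj with rfl | hj
    · rintro rfl; simp at hk
    · exact hs j hj
  · simp only [List.head?_cons, ne_eq, Option.some.injEq]
    rintro rfl; simp at hk

/-- The rate `1/√n` is what later beats the logarithmic growth of the harmonic sum `nestedSum [1]`.
-/
theorem abs_mzv_sub_le {k : ℤ} {s : List ℤ} (hk : 2 ≤ k.natAbs)
    (hs : ∀ j ∈ s, j ≠ 0) (n : ℕ) :
    |mzv (k :: s) - nestedSum (k :: s) n| ≤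
      6 * 2 ^ s.length * (1 / √((n : ℝ) + 1)) := by
  have hadm := admissible_cons_of_two_le hk hs
  have key : ∀ m, |nestedSum (k :: s) (n + m) - nestedSum (k :: s) n| ≤
      6 * 2 ^ s.length * (1 / √((n : ℝ) + 1) - 1 / √(((n + m : ℕ) : ℝ) + 1)) := by
    intro m
    induction m with
    | zero => simp
    | succ m ih =>
      rw [← add_assoc, nestedSum_cons_succ]
      have h1 := abs_nestedCoeff_le hk hs (n + m)
      have h2 := inv_mul_sqrt_le (n + m)
      have h3 : (((n + m : ℕ) : ℝ) + 2) = (((n + m + 1 : ℕ) : ℝ) + 1) := by push_cast; ring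
      rw [h3] at h2
      have h4 := h1.trans (mul_le_mul_of_nonneg_left h2 (by positivity))
      have h5 := abs_add_le (nestedSum (k :: s) (n + m) - nestedSum (k :: s) n)
        (signedTerm k (n + m + 1) * nestedSum s (n + m))
      rw [sub_add_eq_add_sub] at h5
      linarith
  have hlim : Tendsto (fun m => |nestedSum (k :: s) (n + m) - nestedSum (k :: s) n|) atTop
      (𝓝 |mzv (k :: s) - nestedSum (k :: s) n|) := by
    have h := (tendsto_add_atTop_iff_nat n).2 (tendsto_nestedSum hadm)
    exact ((h.congr fun m => by rw [add_comm]).sub_const _).abs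
  refine le_of_tendsto' hlim fun m => (key m).trans ?_
  gcongr
  have : 0 ≤ 1 / √(((n + m : ℕ) : ℝ) + 1) := by positivity
  linarith

theorem nestedSum_one (N : ℕ) : nestedSum [1] N = ∑ n ∈ range N, 1 / ((n : ℝ) + 1) := by
  simp [nestedSum, signedTerm]

theorem nestedSum_one_le (N : ℕ) : nestedSum [1] N ≤ 1 + Real.log (N + 1) := by
  rcases Nat.eq_zero_or_pos N with rfl | hN
  · simp [nestedSum]
  have h := harmonic_le_one_add_log N
  have e : (harmonic N : ℝ) = nestedSum [1] N := by
    rw [nestedSum_one, harmonic]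
    push_cast
    simp
  rw [← e]
  refine h.trans ?_
  have : (0 : ℝ) < N := by exact_mod_cast hN
  gcongr
  linarith

theorem tendsto_nestedSum_one_mul_inv_sqrt :
    Tendsto (fun N : ℕ => nestedSum [1] N * (1 / √((N : ℝ) + 1))) atTop (𝓝 0) := by
  have h1 : Tendsto (fun x : ℝ => (1 + Real.log x) * (1 / √x)) atTop (𝓝 0) := by
    have h := (isLittleO_log_rpow_atTop (r := 1 / 2) (by norm_num)).tendsto_div_nhds_zero
    have h' : Tendsto (fun x : ℝ => 1 / √x) atTop (𝓝 0) := by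
      simp only [one_div]
      exact Real.tendsto_sqrt_atTop.inv_tendsto_atTop
    have := h'.add h
    rw [add_zero] at this
    refine this.congr fun x => ?_
    rw [← Real.sqrt_eq_rpow]
    ring
  refine squeeze_zero (fun N => ?_) (fun N => ?_)
    (h1.comp (tendsto_natCast_atTop_atTop.atTop_add tendsto_const_nhds (C := (1 : ℝ))))
  · rw [nestedSum_one]; positivity
  · exact mul_le_mul_of_nonneg_right (nestedSum_one_le N) (by positivity)

/-- Isolates the finite part of the divergent stuffle product: with `S` the limit of `nestedSum s`,
the sum on the right converges and the last term disappears when `S` is approached at rate `1/√N`.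
-/
theorem nestedSum_one_mul_sub (s : List ℤ) (S : ℝ) (N : ℕ) :
    nestedSum [1] N * nestedSum s N - nestedSum (1 :: s) N =
      (∑ m ∈ range N, (S - nestedSum s m) / ((m : ℝ) + 1)) -
        nestedSum [1] N * (S - nestedSum s N) := by
  have h : nestedSum (1 :: s) N = ∑ m ∈ range N, nestedSum s m / ((m : ℝ) + 1) := by
    simp [nestedSum, signedTerm, div_eq_inv_mul]
  have h2 : ∑ m ∈ range N, (S - nestedSum s m) / ((m : ℝ) + 1) =
      S * nestedSum [1] N - nestedSum (1 :: s) N := by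
    rw [h, nestedSum_one, mul_sum, ← sum_sub_distrib]
    exact sum_congr rfl fun m _ => by ring
  rw [h2]
  ring

theorem hasSum_nestedFun_cons {k : ℤ} {s : List ℤ} (hs : ∀ j ∈ k :: s, j ≠ 0) {t : ℝ}
    (ht : |t| < 1) :
    HasSum (fun m => signedTerm k (m + 1) * nestedSum s m * t ^ (m + 1))
      (nestedFun (k :: s) t) := by
  have : HasSum (fun n => nestedCoeff (k :: s) n * t ^ n) (nestedFun (k :: s) t) :=
    (summable_nestedFun hs ht).of_norm.hasSum
  rw [← hasSum_nat_add_iff' 1] at this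
  simpa only [sum_range_one, nestedCoeff, zero_mul, sub_zero] using this

theorem signedTerm_one (m : ℕ) : signedTerm 1 (m + 1) = 1 / ((m : ℝ) + 1) := by
  simp [signedTerm]

theorem nestedFun_one {t : ℝ} (ht : |t| < 1) : nestedFun [1] t = -Real.log (1 - t) := by
  refine (hasSum_nestedFun_cons (by simp) ht).unique ?_
  refine (Real.hasSum_pow_div_log_of_abs_lt_one ht).congr_fun fun m => ?_
  rw [signedTerm_one, nestedSum]
  ring

/-- Interpolates between the bounds `1` and `n(1-t)`. Any positive exponent defeats `log (1-t)`; one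
below `1/2` keeps the series summable against `n^(-3/2)`, and `1/4` leaves `n^(-5/4)`. -/
theorem one_sub_pow_le {t : ℝ} (ht : t ∈ Set.Ioo (0 : ℝ) 1) (n : ℕ) :
    1 - t ^ n ≤ ((n : ℝ) * (1 - t)) ^ (1 / 4 : ℝ) := by
  have h0 : 0 ≤ 1 - t ^ n := sub_nonneg.2 (pow_le_one₀ ht.1.le ht.2.le)
  have h1 : 1 - t ^ n ≤ 1 := by linarith [pow_nonneg ht.1.le n]
  have h2 : 1 - t ^ n ≤ n * (1 - t) := by
    have := one_add_mul_le_pow (a := t - 1) (by linarith [ht.1]) n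
    rw [add_sub_cancel] at this
    linarith
  calc 1 - t ^ n = (1 - t ^ n) ^ (1 : ℝ) := (Real.rpow_one _).symm
    _ ≤ (1 - t ^ n) ^ (1 / 4 : ℝ) :=
        Real.rpow_le_rpow_of_exponent_ge' h0 h1 (by norm_num) (by norm_num)
    _ ≤ _ := Real.rpow_le_rpow h0 h2 (by norm_num)

theorem abs_nestedFun_sub_le {k : ℤ} {s : List ℤ} (hk : 2 ≤ k.natAbs) (hs : ∀ j ∈ s, j ≠ 0) :
    ∃ C, ∀ t ∈ Set.Ioo (0 : ℝ) 1,
      |nestedFun (k :: s) t - mzv (k :: s)| ≤ C * (1 - t) ^ (1 / 4 : ℝ) := by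
  have hadm := admissible_cons_of_two_le hk hs
  have hval : HasSum (fun m => signedTerm k (m + 1) * nestedSum s m) (mzv (k :: s)) := by
    have h := (summable_nestedCoeff hk hs).hasSum
    rwa [← tendsto_nhds_unique h.tendsto_sum_nat (tendsto_nestedSum hadm)]
  have hsum : Summable fun m : ℕ => ((m : ℝ) + 1) ^ (-(5 / 4) : ℝ) := by
    have := (summable_nat_add_iff 1).2 (Real.summable_nat_rpow.2 (by norm_num : -(5 / 4 : ℝ) < -1))
    exact_mod_cast this
  refine ⟨2 ^ s.length * ∑' m : ℕ, ((m : ℝ) + 1) ^ (-(5 / 4) : ℝ), fun t ht => ?_⟩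
  have hd := (hasSum_nestedFun_cons hadm.1 (abs_lt_one_of_mem_Ioo ht)).sub hval
  have h1t : 0 < 1 - t := sub_pos.2 ht.2
  have hbound : ∀ m : ℕ, ‖signedTerm k (m + 1) * nestedSum s m * t ^ (m + 1) -
      signedTerm k (m + 1) * nestedSum s m‖ ≤
      2 ^ s.length * ((m : ℝ) + 1) ^ (-(5 / 4) : ℝ) * (1 - t) ^ (1 / 4 : ℝ) := by
    intro m
    have hp : (0 : ℝ) < (m : ℝ) + 1 := by positivity
    have h1 := one_sub_pow_le ht (m + 1)
    have h0 : 0 ≤ 1 - t ^ (m + 1) := sub_nonneg.2 (pow_le_one₀ ht.1.le ht.2.le)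
    push_cast at h1
    rw [Real.mul_rpow hp.le h1t.le] at h1
    have e : signedTerm k (m + 1) * nestedSum s m * t ^ (m + 1) -
        signedTerm k (m + 1) * nestedSum s m =
        -(signedTerm k (m + 1) * nestedSum s m * (1 - t ^ (m + 1))) := by ring
    rw [e, norm_neg, norm_mul, Real.norm_eq_abs, Real.norm_eq_abs, abs_of_nonneg h0]
    refine (mul_le_mul (abs_nestedCoeff_le hk hs m) h1 h0 (by positivity)).trans_eq ?_
    have e2 : 1 / (((m : ℝ) + 1) * √((m : ℝ) + 1)) * ((m : ℝ) + 1) ^ (1 / 4 : ℝ) =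
        ((m : ℝ) + 1) ^ (-(5 / 4) : ℝ) := by
      have : 1 / (((m : ℝ) + 1) * √((m : ℝ) + 1)) = ((m : ℝ) + 1) ^ (-(3 / 2) : ℝ) := by
        rw [Real.rpow_neg hp.le, one_div, Real.sqrt_eq_rpow]
        nth_rewrite 1 [← Real.rpow_one ((m : ℝ) + 1)]
        rw [← Real.rpow_add hp]
        norm_num
      rw [this, ← Real.rpow_add hp]
      norm_num
    rw [← e2]
    ring
  rw [← hd.tsum_eq, ← Real.norm_eq_abs]
  refine (tsum_of_norm_bounded ((hsum.hasSum.mul_left _).mul_right _) hbound)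

theorem tendsto_nestedFun_one_mul_sub {k : ℤ} {s : List ℤ} (hk : 2 ≤ k.natAbs)
    (hs : ∀ j ∈ s, j ≠ 0) :
    Tendsto (fun t => nestedFun [1] t * (nestedFun (k :: s) t - mzv (k :: s)))
      (𝓝[<] 1) (𝓝 0) := by
  obtain ⟨C, hC⟩ := abs_nestedFun_sub_le hk hs
  have hlim : Tendsto (fun t : ℝ => 1 - t) (𝓝[<] 1) (𝓝[>] 0) := by
    refine tendsto_nhdsWithin_iff.2 ⟨?_, ?_⟩
    · have : Tendsto (fun t : ℝ => 1 - t) (𝓝 1) (𝓝 (1 - 1)) :=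
        tendsto_const_nhds.sub tendsto_id
      rw [sub_self] at this
      exact this.mono_left nhdsWithin_le_nhds
    · filter_upwards [self_mem_nhdsWithin] with t ht
      exact sub_pos.2 (Set.mem_Iio.1 ht)
  have h := ((tendsto_log_mul_rpow_nhdsGT_zero (r := 1 / 4) (by norm_num)).comp hlim).norm.const_mul C
  rw [norm_zero, mul_zero] at h
  refine squeeze_zero_norm' ?_ h
  filter_upwards [eventually_mem_Ioo] with t ht
  have h1t : 0 < 1 - t := sub_pos.2 ht.2
  rw [nestedFun_one (abs_lt_one_of_mem_Ioo ht), norm_mul, norm_neg, Function.comp_apply,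
    norm_mul, Real.norm_of_nonneg (Real.rpow_nonneg h1t.le _), Real.norm_eq_abs (nestedFun _ _ - _)]
  exact (mul_le_mul_of_nonneg_left (hC t ht) (norm_nonneg _)).trans_eq (by ring)

/-- The regularized double shuffle relation: the stuffle and shuffle products of the divergent
sum `[1]` with a convergent one differ from `[1]` prepended by the same convergent part. -/
theorem regularized_double_shuffle {k : ℤ} {s : List ℤ} {l₁ l₂ : List (List ℤ)}
    (hk : 2 ≤ k.natAbs) (hs : ∀ j ∈ s, j ≠ 0) (hl₁ : ∀ r ∈ l₁, Admissible r)
    (hl₂ : ∀ r ∈ l₂, Admissible r) (h₁ : stuffle [1] (k :: s) = (1 :: k :: s) :: l₁)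
    (h₂ : shuffle (toWord [1]) (toWord (k :: s)) = ((1 :: k :: s) :: l₂).map toWord) :
    (l₁.map mzv).sum = (l₂.map mzv).sum := by
  have hadm := admissible_cons_of_two_le hk hs
  set S := mzv (k :: s) with hS
  set d : ℕ → ℝ := fun m => (S - nestedSum (k :: s) m) / ((m : ℝ) + 1) with hd
  have hdsum : Summable d := by
    refine .of_norm_bounded (summable_inv_mul_sqrt.mul_left (6 * 2 ^ s.length)) fun m => ?_
    have hp : (0 : ℝ) < (m : ℝ) + 1 := by positivity
    rw [hd, norm_div, Real.norm_eq_abs, Real.norm_of_nonneg hp.le, div_le_iff₀ hp]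
    refine (abs_mzv_sub_le hk hs m).trans_eq ?_
    field_simp
  have hone : ∀ j ∈ [(1 : ℤ)], j ≠ 0 := by simp
  have hcons : ∀ j ∈ 1 :: k :: s, j ≠ 0 := by
    intro j hj
    rcases List.mem_cons.1 hj with rfl | hj
    · exact one_ne_zero
    · exact hadm.1 j hj
  -- Both regularized products are compared with the same series `∑ d m`. On the stuffle side the
  -- partial sums differ from it by `H_N` times a tail of order `1/√N`.
  have hA : (l₁.map mzv).sum = ∑' m, d m := by
    refine tendsto_nhds_unique (tendsto_sum_map_nestedSum hl₁) ?_
    have hR : Tendsto (fun N => nestedSum [1] N * (S - nestedSum (k :: s) N)) atTop (𝓝 0) := by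
      refine squeeze_zero_norm (fun N => ?_)
        (by simpa using tendsto_nestedSum_one_mul_inv_sqrt.const_mul (6 * 2 ^ s.length))
      have h1 : 0 ≤ nestedSum [1] N := by rw [nestedSum_one]; positivity
      rw [norm_mul, Real.norm_of_nonneg h1, Real.norm_eq_abs]
      refine (mul_le_mul_of_nonneg_left (abs_mzv_sub_le hk hs N) h1).trans_eq (by ring)
    have h := hdsum.hasSum.tendsto_sum_nat.sub hR
    rw [sub_zero] at h
    refine h.congr fun N => ?_
    rw [← nestedSum_one_mul_sub, nestedSum_mul, h₁, List.map_cons, List.sum_cons,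
      add_sub_cancel_left]
  -- On the shuffle side the generating function equals `t * ∑ d m t^m` up to `nestedFun [1] t *
  -- (nestedFun (k :: s) t - S)`, a logarithm times `O((1-t)^(1/4))`.
  have hB : (l₂.map mzv).sum = ∑' m, d m := by
    refine tendsto_nhds_unique (tendsto_sum_map_nestedFun hl₂) ?_
    have h1 : Tendsto (fun t : ℝ => t * ∑' m, d m * t ^ m) (𝓝[<] 1) (𝓝 (1 * ∑' m, d m)) :=
      (tendsto_id.mono_left nhdsWithin_le_nhds).mul
        (Real.tendsto_tsum_powerSeries_nhdsWithin_lt hdsum.hasSum.tendsto_sum_nat)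
    have h := h1.add (tendsto_nestedFun_one_mul_sub hk hs)
    rw [one_mul, add_zero] at h
    refine h.congr' ?_
    filter_upwards [eventually_mem_Ioo] with t ht
    have ht1 := abs_lt_one_of_mem_Ioo ht
    have hmul := nestedFun_mul (u := [1]) hone hadm.1 (l := (1 :: k :: s) :: l₂) (by
      intro r hr
      rcases List.mem_cons.1 hr with rfl | hr
      · exact hcons
      · exact (hl₂ r hr).1) h₂ ht1
    rw [List.map_cons, List.sum_cons] at hmul
    have e1 := ((hasSum_nestedFun_cons hone ht1).mul_left S).sub
      (hasSum_nestedFun_cons hcons ht1)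
    have e2 : HasSum (fun m => t * (d m * t ^ m)) (S * nestedFun [1] t - nestedFun (1 :: k :: s) t) := by
      refine e1.congr_fun fun m => ?_
      rw [hd, signedTerm_one, nestedSum]
      ring
    rw [← tsum_mul_left, e2.tsum_eq]
    linear_combination hmul
  rw [hA, hB]

/-! ### Values of depth one -/

theorem nestedFun_neg_one {t : ℝ} (ht : |t| < 1) : nestedFun [-1] t = -Real.log (1 + t) := by
  have h := Real.hasSum_pow_div_log_of_abs_lt_one (x := -t) (by rwa [abs_neg])
  rw [sub_neg_eq_add] at h
  refine (hasSum_nestedFun_cons (by simp) ht).unique (h.congr_fun fun m => ?_)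
  simp only [signedTerm, nestedSum]
  norm_num [neg_pow t]
  ring

theorem mzv_neg_one : mzv [-1] = -Real.log 2 := by
  refine tendsto_nhds_unique (tendsto_nestedFun (s := [-1]) (by decide)) ?_
  have h : Tendsto (fun t : ℝ => -Real.log (1 + t)) (𝓝 1) (𝓝 (-Real.log (1 + 1))) :=
    ((tendsto_const_nhds.add tendsto_id).log (by norm_num)).neg
  rw [one_add_one_eq_two] at h
  refine (h.mono_left nhdsWithin_le_nhds).congr' ?_
  filter_upwards [eventually_mem_Ioo] with t ht
  rw [nestedFun_neg_one (abs_lt_one_of_mem_Ioo ht)]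

theorem nestedSum_singleton (k N : ℕ) (hk : k ≠ 0) :
    nestedSum [(k : ℤ)] N = ∑ n ∈ range N, 1 / ((n : ℝ) + 1) ^ k := by
  have h : (k : ℤ).sign = 1 := Int.sign_eq_one_of_pos (by omega)
  simp [nestedSum, signedTerm, h]

theorem nestedSum_singleton_neg (k N : ℕ) (hk : k ≠ 0) :
    nestedSum [-(k : ℤ)] N = ∑ n ∈ range N, (-1) ^ (n + 1) / ((n : ℝ) + 1) ^ k := by
  have h : (-(k : ℤ)).sign = -1 := Int.sign_eq_neg_one_of_neg (by omega)
  simp only [nestedSum, signedTerm, h]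
  simp

theorem mzv_natCast {k : ℕ} (hk : 2 ≤ k) : mzv [(k : ℤ)] = zetaVal k := by
  refine tendsto_nhds_unique (tendsto_nestedSum
    (admissible_cons_of_two_le (by simpa using hk) (by simp))) ?_
  have h := (Real.summable_one_div_nat_pow.2 (by omega : 1 < k)).hasSum
  rw [← zetaVal_eq_tsum hk, ← hasSum_nat_add_iff' 1] at h
  have h0 : ((0 : ℕ) : ℝ) ^ k = 0 := by simp; omega
  rw [sum_range_one, h0, div_zero, sub_zero] at h
  refine h.tendsto_sum_nat.congr fun N => ?_
  rw [nestedSum_singleton k N (by omega)]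
  simp

/-- Odd indices cancel between the two sums, and even indices `2n` are counted twice. -/
theorem nestedSum_distribution (k N : ℕ) (hk : k ≠ 0) :
    nestedSum [-(k : ℤ)] (2 * N) + nestedSum [(k : ℤ)] (2 * N) =
      2 / 2 ^ k * nestedSum [(k : ℤ)] N := by
  simp only [nestedSum_singleton _ _ hk, nestedSum_singleton_neg _ _ hk]
  induction N with
  | zero => simp
  | succ N ih =>
    rw [mul_add, mul_one, sum_range_succ, sum_range_succ, sum_range_succ _ (2 * N + 1),
      sum_range_succ _ (2 * N), sum_range_succ _ N, mul_add, ← ih]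
    have h1 : (((2 * N + 1 : ℕ) : ℝ) + 1) = 2 * (N + 1) := by push_cast; ring
    have h2 : (-1 : ℝ) ^ (2 * N + 1) = -1 := by rw [pow_succ, pow_mul]; simp
    have h3 : (-1 : ℝ) ^ (2 * N + 1 + 1) = 1 := by rw [pow_succ, h2]; norm_num
    rw [h1, h2, h3, mul_pow]
    field_simp
    ring

/-- The value of the alternating zeta series. -/
theorem mzv_neg_natCast {k : ℕ} (hk : 2 ≤ k) :
    mzv [-(k : ℤ)] = (2 / 2 ^ k - 1) * zetaVal k := by
  have h2 : Tendsto (fun N : ℕ => 2 * N) atTop atTop :=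
    tendsto_id.const_mul_atTop' two_pos
  have hp := tendsto_nestedSum (s := [(k : ℤ)])
    (admissible_cons_of_two_le (by simpa using hk) (by simp))
  have hm := tendsto_nestedSum (s := [-(k : ℤ)])
    (admissible_cons_of_two_le (by simpa using hk) (by simp))
  have h := tendsto_nhds_unique (((hm.add hp).comp h2).congr fun N =>
    nestedSum_distribution k N (by omega)) (hp.const_mul (2 / 2 ^ k))
  rw [mzv_natCast hk] at h
  linarith

theorem zetaVal_two : zetaVal 2 = Real.pi ^ 2 / 6 := by
  rw [zetaVal_eq_tsum le_rfl, hasSum_zeta_two.tsum_eq]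

theorem zetaVal_four : zetaVal 4 = Real.pi ^ 4 / 90 := by
  rw [zetaVal_eq_tsum (by norm_num), hasSum_zeta_four.tsum_eq]

theorem zetaVal_six : zetaVal 6 = Real.pi ^ 6 / 945 := by
  have h := hasSum_zeta_nat (k := 3) (by norm_num)
  rw [zetaVal_eq_tsum (by norm_num)]
  refine h.tsum_eq.trans ?_
  have hb : bernoulli 6 = 1 / 42 := by
    rw [bernoulli_eq_bernoulli'_of_ne_one (by norm_num), bernoulli'_def]
    simp only [sum_range_succ, range_zero, sum_empty, bernoulli'_zero, bernoulli'_one,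
      bernoulli'_two, bernoulli'_three, bernoulli'_four]
    have h5 : bernoulli' 5 = 0 := by
      rw [bernoulli'_def]
      simp only [sum_range_succ, range_zero, sum_empty, bernoulli'_zero, bernoulli'_one,
        bernoulli'_two, bernoulli'_three, bernoulli'_four]
      norm_num [Nat.choose]
    rw [h5]
    norm_num [Nat.choose]
  norm_num [hb, Nat.factorial]
  ring

/-! ### The value at one half of the quadrilogarithm -/

/-- The function of a real variable defined by the power series of a word. -/
def wordFun (w : List ℤ) (t : ℝ) : ℝ := ∑' n, PowerSeries.coeff n (wordSeries w) * t ^ n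

theorem wordFun_toWord {s : List ℤ} (hs : ∀ k ∈ s, k ≠ 0) (t : ℝ) :
    wordFun (toWord s) t = nestedFun s t := by
  simp only [wordFun, nestedFun, coeff_wordSeries_toWord hs]

theorem abs_intCast_le_one {a : ℤ} (ha : a.natAbs ≤ 1) : |(a : ℝ)| ≤ 1 := by
  have : |a| ≤ 1 := by rw [Int.abs_eq_natAbs]; exact_mod_cast ha
  exact_mod_cast this

theorem abs_coeff_letterSeries_le {a : ℤ} (ha : a.natAbs ≤ 1) (n : ℕ) :
    |PowerSeries.coeff n (letterSeries a)| ≤ 1 := by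
  rw [letterSeries]
  split_ifs with h
  · rw [PowerSeries.coeff_one]
    split_ifs <;> simp
  · rw [PowerSeries.coeff_mk]
    split_ifs
    · simp
    · rw [abs_pow]
      exact pow_le_one₀ (abs_nonneg _) (abs_intCast_le_one ha)

/-- After convolution with a letter the coefficient at `n + 1` has `n + 1` terms of size at most
`1`, and integration divides by `n + 1`. -/
theorem abs_coeff_wordSeries_le {w : List ℤ} (hw : ∀ a ∈ w, a.natAbs ≤ 1) (n : ℕ) :
    |PowerSeries.coeff n (wordSeries w)| ≤ 1 := by
  induction w generalizing n with
  | nil =>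
    rw [wordSeries, PowerSeries.coeff_one]
    split_ifs <;> simp
  | cons a w ih =>
    have ih' := ih fun b hb => hw b (by simp [hb])
    rcases n with _ | n
    · rw [PowerSeries.coeff_zero_eq_constantCoeff_apply, constantCoeff_wordSeries_cons]
      simp
    have hp : (1 : ℝ) ≤ ((n + 1 : ℕ) : ℝ) := by simp
    rw [wordSeries, PowerSeries.coeff_mk, abs_div, Nat.abs_cast, div_le_one (by linarith)]
    rcases eq_or_ne a 0 with rfl | ha
    · rw [letterSeries, if_pos rfl, one_mul]
      exact (ih' _).trans hp
    · rw [coeff_letterSeries_mul ha]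
      refine (abs_sum_le_sum_abs _ _).trans ?_
      refine (sum_le_card_nsmul _ _ 1 fun i _ => ?_).trans_eq (by simp)
      rw [abs_mul, abs_pow]
      exact mul_le_one₀ (ih' i) (by positivity)
        (pow_le_one₀ (abs_nonneg _) (abs_intCast_le_one (hw a (by simp))))

theorem hasDerivAt_tsum_mul_pow {a : ℕ → ℝ} (ha : ∀ n, |a n| ≤ 1) {t : ℝ} (ht : |t| < 1) :
    HasDerivAt (fun x => ∑' n, a n * x ^ n) (∑' n, a n * (n * t ^ (n - 1))) t := by
  obtain ⟨r, hr, hr1⟩ := exists_between ht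
  have hr0 : 0 ≤ r := (abs_nonneg t).trans hr.le
  have hsum : Summable fun n : ℕ => (n : ℝ) * r ^ (n - 1) := by
    rw [← summable_nat_add_iff 1]
    have h := (summable_pow_mul_geometric_of_norm_lt_one 1
      (by rwa [Real.norm_of_nonneg hr0] : ‖r‖ < 1)).add
      (summable_geometric_of_lt_one hr0 hr1)
    refine h.congr fun n => ?_
    push_cast
    ring
  have hmem : ∀ x ∈ Metric.ball (0 : ℝ) r, |x| ≤ r := fun x hx => by
    simpa using (Metric.mem_ball.1 hx).le
  refine hasDerivAt_tsum_of_isPreconnected hsum Metric.isOpen_ball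
    (convex_ball (0 : ℝ) r).isPreconnected
    (fun n x _ => (hasDerivAt_pow n x).const_mul (a n)) (fun n x hx => ?_)
    (y₀ := t) (by simpa using hr) (summable_norm_mul_pow ha ht).of_norm (by simpa using hr)
  rw [norm_mul, norm_mul, norm_pow, Real.norm_eq_abs, Real.norm_natCast, Real.norm_eq_abs]
  have h1 : |x| ^ (n - 1) ≤ r ^ (n - 1) := pow_le_pow_left₀ (abs_nonneg _) (hmem x hx) _
  calc |a n| * (n * |x| ^ (n - 1)) ≤ 1 * (n * r ^ (n - 1)) :=
        mul_le_mul (ha n) (by gcongr) (by positivity) zero_le_one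
    _ = _ := one_mul _

theorem tsum_coeff_mul {f g : PowerSeries ℝ} (hf : ∀ n, |PowerSeries.coeff n f| ≤ 1)
    (hg : ∀ n, |PowerSeries.coeff n g| ≤ 1) {t : ℝ} (ht : |t| < 1) :
    ∑' n, PowerSeries.coeff n (f * g) * t ^ n =
      (∑' n, PowerSeries.coeff n f * t ^ n) * ∑' n, PowerSeries.coeff n g * t ^ n := by
  rw [tsum_mul_tsum_eq_tsum_sum_antidiagonal_of_summable_norm
    (summable_norm_mul_pow hf ht) (summable_norm_mul_pow hg ht)]
  refine tsum_congr fun n => ?_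
  rw [PowerSeries.coeff_mul, sum_mul]
  refine sum_congr rfl fun p hp => ?_
  rw [← Finset.HasAntidiagonal.mem_antidiagonal.1 hp, pow_add]
  ring

/-- Analytic form of `X_mul_derivative_wordSeries`; keeping the factor `t` avoids dividing at `t =
0`. -/
theorem exists_hasDerivAt_wordFun {a : ℤ} {w : List ℤ} (h : a ≠ 0 ∨ w ≠ [])
    (hw : ∀ b ∈ a :: w, b.natAbs ≤ 1) {t : ℝ} (ht : |t| < 1) :
    ∃ d, HasDerivAt (wordFun (a :: w)) d t ∧
      t * d = (∑' n, PowerSeries.coeff n (letterSeries a) * t ^ n) * wordFun w t := by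
  refine ⟨_, hasDerivAt_tsum_mul_pow (abs_coeff_wordSeries_le hw) ht, ?_⟩
  rw [wordFun, ← tsum_coeff_mul (abs_coeff_letterSeries_le (hw a (by simp)))
    (abs_coeff_wordSeries_le fun b hb => hw b (by simp [hb])) ht,
    ← X_mul_derivative_wordSeries h, ← tsum_mul_left]
  refine tsum_congr fun n => ?_
  rcases n with _ | n
  · simp
  · rw [PowerSeries.coeff_succ_X_mul, PowerSeries.coeff_derivative]
    push_cast
    ring

theorem tsum_letterSeries_zero (t : ℝ) :
    ∑' n, PowerSeries.coeff n (letterSeries 0) * t ^ n = 1 := by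
  rw [letterSeries, if_pos rfl, tsum_eq_single 0]
  · simp
  · intro n hn
    rw [PowerSeries.coeff_one, if_neg hn, zero_mul]

theorem tsum_letterSeries_neg_one {t : ℝ} (ht : |t| < 1) :
    ∑' n, PowerSeries.coeff n (letterSeries (-1)) * t ^ n = -t / (1 + t) := by
  have h := (hasSum_geometric_of_abs_lt_one (r := -t) (by rwa [abs_neg])).mul_left (-t)
  rw [sub_neg_eq_add] at h
  refine HasSum.tsum_eq ?_
  rw [← hasSum_nat_add_iff' 1]
  simp only [letterSeries, sum_range_one]
  norm_num
  rw [neg_div, div_eq_mul_inv, ← neg_mul]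
  refine h.congr_fun fun n => ?_
  rw [neg_pow t, pow_succ (-1 : ℝ), pow_succ t]
  ring

/-- The words with `k` letters in `{0, -1}` followed by the letter `-1`. -/
def halfWords : ℕ → List (List ℤ)
  | 0 => [[-1]]
  | k + 1 => (halfWords k).map (List.cons 0) ++ (halfWords k).map (List.cons (-1))

theorem mem_halfWords {k : ℕ} {w : List ℤ} (h : w ∈ halfWords k) :
    w ≠ [] ∧ ∀ b ∈ w, b.natAbs ≤ 1 := by
  induction k generalizing w with
  | zero => simp [halfWords] at h; simp [h]
  | succ k ih =>
    rw [halfWords, List.mem_append, List.mem_map, List.mem_map] at h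
    rcases h with ⟨x, hx, rfl⟩ | ⟨x, hx, rfl⟩ <;>
    · refine ⟨by simp, fun b hb => ?_⟩
      rcases List.mem_cons.1 hb with rfl | hb
      · simp
      · exact (ih hx).2 b hb

theorem exists_hasDerivAt_sum_map_cons {a : ℤ} (ha : a.natAbs ≤ 1) {l : List (List ℤ)}
    (hl : ∀ w ∈ l, w ≠ [] ∧ ∀ b ∈ w, b.natAbs ≤ 1) {t : ℝ} (ht : |t| < 1) :
    ∃ d, HasDerivAt (fun x => ((l.map (List.cons a)).map fun w => wordFun w x).sum) d t ∧
      t * d = (∑' n, PowerSeries.coeff n (letterSeries a) * t ^ n) *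
        (l.map fun w => wordFun w t).sum := by
  induction l with
  | nil => exact ⟨0, by simpa using hasDerivAt_const t (0 : ℝ), by simp⟩
  | cons w l ih =>
    obtain ⟨d₁, h₁, e₁⟩ := ih fun x hx => hl x (by simp [hx])
    have hw := hl w (by simp)
    obtain ⟨d₂, h₂, e₂⟩ := exists_hasDerivAt_wordFun (a := a) (w := w) (.inr hw.1) (by
      intro b hb
      rcases List.mem_cons.1 hb with rfl | hb
      · exact ha
      · exact hw.2 b hb) ht
    refine ⟨d₂ + d₁, ?_, ?_⟩
    · simp only [List.map_cons, List.sum_cons]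
      exact h₂.add h₁
    rw [List.map_cons, List.sum_cons, mul_add, mul_add, e₁, e₂]

theorem wordFun_cons_zero (a : ℤ) (w : List ℤ) : wordFun (a :: w) 0 = 0 := by
  rw [wordFun, tsum_eq_single 0]
  · rw [PowerSeries.coeff_zero_eq_constantCoeff_apply, constantCoeff_wordSeries_cons, zero_mul]
  · intro n hn
    rw [zero_pow hn, mul_zero]

theorem sum_map_cons_wordFun_zero (a : ℤ) (l : List (List ℤ)) :
    ((l.map (List.cons a)).map fun w => wordFun w 0).sum = 0 := by
  induction l with
  | nil => simp
  | cons w l ih =>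
    simp only [List.map_cons, List.sum_cons, ih, wordFun_cons_zero, add_zero]

/-- For `u = t/(1+t)` one has `du/u = dt/t - dt/(1+t)` and `du/(1-u) = dt/(1+t)`. The letter `0`
thus becomes the sum of the letters `0` and `-1`, and the letter `1` becomes minus the letter `-1`.
-/
theorem wordFun_div_one_add (k : ℕ) {t : ℝ} (ht : t ∈ Set.Ico (0 : ℝ) 1) :
    wordFun (List.replicate k 0 ++ [1]) (t / (1 + t)) =
      -((halfWords k).map fun w => wordFun w t).sum := by
  induction k generalizing t with
  | zero =>
    have hp : 0 < 1 + t := by linarith [ht.1]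
    have ht1 : |t| < 1 := by rw [abs_of_nonneg ht.1]; exact ht.2
    have hy1 : |t / (1 + t)| < 1 := by
      rw [abs_of_nonneg (div_nonneg ht.1 hp.le), div_lt_one hp]; linarith
    have e1 : 1 - t / (1 + t) = (1 + t)⁻¹ := by field_simp; ring
    have h1 := wordFun_toWord (s := [1]) (by simp) (t / (1 + t))
    have h2 := wordFun_toWord (s := [-1]) (by simp) t
    rw [nestedFun_one hy1, e1, Real.log_inv, neg_neg] at h1
    rw [nestedFun_neg_one ht1] at h2
    simp only [halfWords, List.map_cons, List.map_nil, List.sum_cons, List.sum_nil, add_zero]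
    exact h1.trans (by rw [← neg_neg (Real.log _), ← h2]; rfl)
  | succ k ih =>
    set f : ℝ → ℝ := fun x => wordFun (List.replicate (k + 1) 0 ++ [1]) (x / (1 + x)) +
      ((halfWords (k + 1)).map fun w => wordFun w x).sum with hf
    have hder : ∀ x ∈ Set.Ico (0 : ℝ) 1, ∃ d, HasDerivAt f d x ∧ x * d = 0 := by
      intro x hx
      have hp : 0 < 1 + x := by linarith [hx.1]
      have hx1 : |x| < 1 := by rw [abs_of_nonneg hx.1]; exact hx.2
      have hy1 : |x / (1 + x)| < 1 := by
        rw [abs_of_nonneg (div_nonneg hx.1 hp.le), div_lt_one hp]; linarith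
      obtain ⟨d₁, h₁, e₁⟩ := exists_hasDerivAt_wordFun (a := 0)
        (w := List.replicate k 0 ++ [1]) (.inr (by simp)) (by
          intro b hb
          simp only [List.mem_cons, List.mem_append, List.mem_replicate] at hb
          rcases hb with rfl | ⟨-, rfl⟩ | rfl | h <;> simp_all) hy1
      obtain ⟨d₂, h₂, e₂⟩ := exists_hasDerivAt_sum_map_cons (a := 0) (by simp)
        (fun w hw => mem_halfWords (k := k) hw) hx1
      obtain ⟨d₃, h₃, e₃⟩ := exists_hasDerivAt_sum_map_cons (a := -1) (by simp)
        (fun w hw => mem_halfWords (k := k) hw) hx1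
      have hq : HasDerivAt (fun x : ℝ => x / (1 + x)) (1 / (1 + x) ^ 2) x := by
        have := (hasDerivAt_id x).div ((hasDerivAt_id x).const_add 1) hp.ne'
        convert! this using 1
        simp
      refine ⟨d₁ * (1 / (1 + x) ^ 2) + (d₂ + d₃), ?_, ?_⟩
      · have hg := HasDerivAt.comp (h := fun x : ℝ => x / (1 + x)) x h₁ hq
        simp only [hf, halfWords, List.map_append, List.sum_append]
        exact hg.add (h₂.add h₃)
      · rw [tsum_letterSeries_zero, one_mul, ih hx] at e₁
        rw [tsum_letterSeries_zero, one_mul] at e₂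
        rw [tsum_letterSeries_neg_one hx1] at e₃
        field_simp at e₁ e₃ ⊢
        linear_combination e₁ + (1 + x) ^ 2 * e₂ + (1 + x) * e₃
    have hzero : f 0 = 0 := by
      simp only [hf, halfWords, List.map_append, List.sum_append, sum_map_cons_wordFun_zero,
        List.replicate_succ, List.cons_append, zero_div, wordFun_cons_zero, add_zero]
    suffices f t = 0 by linarith
    rcases ht.1.eq_or_lt with rfl | htp
    · exact hzero
    choose! d hd using hder
    -- The relation `x * d x = 0` says nothing at `x = 0`, so the mean value theorem is used: its
    -- point `c` is interior and there `d c = 0`.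
    obtain ⟨c, hc, e⟩ := exists_hasDerivAt_eq_slope f d htp
      (fun x hx => (hd x ⟨hx.1, hx.2.trans_lt ht.2⟩).1.continuousAt.continuousWithinAt)
      (fun x hx => (hd x ⟨hx.1.le, hx.2.trans ht.2⟩).1)
    have h0 := (hd c ⟨hc.1.le, hc.2.trans ht.2⟩).2
    have : d c = 0 := by simpa [hc.1.ne'] using h0
    rw [this, hzero, eq_comm, div_eq_zero_iff] at e
    rcases e with e | e <;> linarith

theorem polylog_four_half_eq_nestedFun : polylog 4 (1 / 2) = nestedFun [4] (1 / 2) := by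
  refine HasSum.tsum_eq ?_
  refine (hasSum_nestedFun_cons (k := 4) (s := []) (by decide)
    (by norm_num : |(1 / 2 : ℝ)| < 1)).congr_fun fun m => ?_
  have h : (4 : ℤ).sign = 1 := rfl
  simp only [signedTerm, nestedSum, h]
  norm_num
  ring

/-- The quadrilogarithm at one half as a combination of alternating nested sums. -/
theorem polylog_four_half_eq_sum {l : List (List ℤ)} (hl : ∀ s ∈ l, Admissible s)
    (h : halfWords 3 = l.map toWord) : polylog 4 (1 / 2) = -(l.map mzv).sum := by
  have h1 : ContinuousAt (nestedFun [4]) (1 / 2) := by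
    obtain ⟨d, hd, -⟩ := exists_hasDerivAt_wordFun (a := 0) (w := [0, 0, 1]) (by decide)
      (by decide) (by norm_num : |(1 / 2 : ℝ)| < 1)
    exact hd.continuousAt.congr
      (.of_forall fun t => wordFun_toWord (s := [4]) (by decide) t)
  -- As `t → 1⁻` the argument tends to `1/2`, inside the disc of convergence, while the alternating
  -- side reaches its limit by Abel's theorem.
  have h2 : Tendsto (fun t : ℝ => t / (1 + t)) (𝓝[<] 1) (𝓝 (1 / 2)) := by
    have : Tendsto (fun t : ℝ => t / (1 + t)) (𝓝 1) (𝓝 (1 / (1 + 1))) :=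
      tendsto_id.div (tendsto_const_nhds.add tendsto_id) (by norm_num)
    rw [one_add_one_eq_two] at this
    exact this.mono_left nhdsWithin_le_nhds
  rw [polylog_four_half_eq_nestedFun]
  refine tendsto_nhds_unique (h1.tendsto.comp h2)
    ((tendsto_sum_map_nestedFun hl).neg.congr' ?_)
  filter_upwards [eventually_mem_Ioo] with t ht
  have h3 := wordFun_div_one_add 3 (Set.Ioo_subset_Ico_self ht)
  rw [h, List.map_map] at h3
  have h4 : l.map ((fun w => wordFun w t) ∘ toWord) = l.map fun s => nestedFun s t :=
    List.map_congr_left fun s hs => wordFun_toWord (hl s hs).1 t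
  rw [h4] at h3
  rw [← h3, Function.comp_apply, ← wordFun_toWord (by decide)]
  rfl

/-! ### Relations between values of nested sums -/

/-- The expansion is supplied explicitly and verified, together with admissibility, by evaluation in
the default argument. -/
theorem stuffle_value (u v : List ℤ) (l : List (List ℤ))
    (h : stuffle u v = l ∧ Admissible u ∧ Admissible v ∧ ∀ s ∈ l, Admissible s := by decide) :
    mzv u * mzv v = (l.map mzv).sum := by
  obtain ⟨rfl, hu, hv, hl⟩ := h
  exact mzv_mul_stuffle hu hv hl

theorem shuffle_value (u v : List ℤ) (l : List (List ℤ))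
    (h : shuffle (toWord u) (toWord v) = l.map toWord ∧ Admissible u ∧ Admissible v ∧
      ∀ s ∈ l, Admissible s := by decide) :
    mzv u * mzv v = (l.map mzv).sum :=
  mzv_mul_shuffle h.2.1 h.2.2.1 h.2.2.2 h.1

theorem regularized_value (k : ℤ) (s : List ℤ) (l₁ l₂ : List (List ℤ))
    (h : stuffle [1] (k :: s) = (1 :: k :: s) :: l₁ ∧
      shuffle (toWord [1]) (toWord (k :: s)) = ((1 :: k :: s) :: l₂).map toWord ∧
      2 ≤ k.natAbs ∧ (∀ j ∈ s, j ≠ 0) ∧ (∀ r ∈ l₁, Admissible r) ∧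
      ∀ r ∈ l₂, Admissible r := by decide) :
    (l₁.map mzv).sum = (l₂.map mzv).sum :=
  regularized_double_shuffle h.2.2.1 h.2.2.2.1 h.2.2.2.2.1 h.2.2.2.2.2 h.1 h.2.1

theorem mzv_neg_natCast_eq_mul {k : ℕ} (hk : 2 ≤ k) :
    mzv [-(k : ℤ)] = (2 / 2 ^ k - 1) * mzv [(k : ℤ)] := by
  rw [mzv_neg_natCast hk, mzv_natCast hk]

theorem mzv_neg_two : mzv [-2] = -1 / 2 * mzv [2] :=
  (mzv_neg_natCast_eq_mul (k := 2) (by norm_num)).trans (by norm_num)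

theorem mzv_neg_three : mzv [-3] = -3 / 4 * mzv [3] :=
  (mzv_neg_natCast_eq_mul (k := 3) (by norm_num)).trans (by norm_num)

theorem mzv_neg_four : mzv [-4] = -7 / 8 * mzv [4] :=
  (mzv_neg_natCast_eq_mul (k := 4) (by norm_num)).trans (by norm_num)

theorem mzv_neg_five : mzv [-5] = -15 / 16 * mzv [5] :=
  (mzv_neg_natCast_eq_mul (k := 5) (by norm_num)).trans (by norm_num)

theorem mzv_neg_six : mzv [-6] = -31 / 32 * mzv [6] :=
  (mzv_neg_natCast_eq_mul (k := 6) (by norm_num)).trans (by norm_num)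

theorem mzv_two_mul_two : mzv [2] * mzv [2] = 5 / 2 * mzv [4] := by
  have h2 := mzv_natCast (k := 2) le_rfl
  have h4 := mzv_natCast (k := 4) (by norm_num)
  rw [zetaVal_two] at h2
  rw [zetaVal_four] at h4
  norm_num at h2 h4
  rw [h2, h4]
  ring

theorem mzv_two_mul_four : mzv [2] * mzv [4] = 7 / 4 * mzv [6] := by
  have h2 := mzv_natCast (k := 2) le_rfl
  have h4 := mzv_natCast (k := 4) (by norm_num)
  have h6 := mzv_natCast (k := 6) (by norm_num)
  rw [zetaVal_two] at h2
  rw [zetaVal_four] at h4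
  rw [zetaVal_six] at h6
  norm_num at h2 h4 h6
  rw [h2, h4, h6]
  ring

/-- Trades `Li_4(1/2)` for the double value `mzv [-2, 2]`. Multiplied by `mzv [2]`, this is how the
quadrilogarithm enters the weight-six identities. -/
theorem polylog_four_half :
    4 * polylog 4 (1 / 2) = 65 / 16 * mzv [4] + 7 / 2 * mzv [-1] * mzv [3] +
      mzv [-1] ^ 2 * mzv [2] - 1 / 6 * mzv [-1] ^ 4 - mzv [-2, 2] := by
  have hL := polylog_four_half_eq_sum
    (l := [[-4], [-3, 1], [-2, 2], [-2, 1, 1], [-1, 3], [-1, 2, 1], [-1, 1, 2], [-1, 1, 1, 1]])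
    (by decide) (by decide)
  -- Hypotheses named `w…` are shuffle and `s…` stuffle relations, labelled by their two factors,
  -- with `m` for a minus sign.
  have wm11_m11 := shuffle_value [-1, 1] [-1, 1] [[-1, 1, 1, 1], [-1, 1, 1, 1], [-1, 1, 1, 1],
    [-1, 1, 1, 1], [-1, 1, 1, 1], [-1, 1, 1, 1]]
  have wm1_m12 := shuffle_value [-1] [-1, 2] [[-1, 1, 2], [-1, 1, 2], [-1, 2, 1], [-1, 2, 1]]
  have wm1_m1 := shuffle_value [-1] [-1] [[-1, 1], [-1, 1]]
  have wm1_m2m1 := shuffle_value [-1] [-2, -1] [[-1, 2, -1], [-2, 1, -1], [-2, 1, -1],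
    [-2, -1, -1]]
  have wm1_m21 := shuffle_value [-1] [-2, 1] [[-1, 2, 1], [-2, 1, 1], [-2, 1, 1], [-2, 1, 1]]
  have wm1_2m1 := shuffle_value [-1] [2, -1] [[-1, -2, -1], [-2, -1, -1], [2, -1, 1], [2, -1, 1]]
  have wm1_21 := shuffle_value [-1] [2, 1] [[-1, -2, 1], [-2, -1, 1], [2, -1, -1], [2, 1, -1]]
  have wm1_2 := shuffle_value [-1] [2] [[-1, -2], [-2, -1], [2, -1]]
  have wm1_3 := shuffle_value [-1] [3] [[-1, -3], [-2, -2], [-3, -1], [3, -1]]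
  have wm2_m2 := shuffle_value [-2] [-2] [[-2, 2], [-3, 1], [-3, 1], [-3, 1], [-3, 1], [-2, 2]]
  have wm2_2 := shuffle_value [-2] [2] [[-2, -2], [-3, -1], [3, -1], [-3, -1], [3, -1], [2, -2]]
  have w2_2 := shuffle_value [2] [2] [[2, 2], [3, 1], [3, 1], [3, 1], [3, 1], [2, 2]]
  have sm1_m2m1 := stuffle_value [-1] [-2, -1] [[-1, -2, -1], [-2, -1, -1], [-2, -1, -1], [-2, 2],
    [3, -1]]
  have sm1_m21 := stuffle_value [-1] [-2, 1] [[-1, -2, 1], [-2, -1, 1], [-2, 1, -1], [-2, -2],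
    [3, 1]]
  have sm1_m2 := stuffle_value [-1] [-2] [[-1, -2], [-2, -1], [3]]
  have sm1_m3 := stuffle_value [-1] [-3] [[-1, -3], [-3, -1], [4]]
  have sm1_2m1 := stuffle_value [-1] [2, -1] [[-1, 2, -1], [2, -1, -1], [2, -1, -1], [2, 2],
    [-3, -1]]
  have sm1_21 := stuffle_value [-1] [2, 1] [[-1, 2, 1], [2, -1, 1], [2, 1, -1], [2, -2], [-3, 1]]
  have sm1_2 := stuffle_value [-1] [2] [[-1, 2], [2, -1], [-3]]
  have sm1_3 := stuffle_value [-1] [3] [[-1, 3], [3, -1], [-4]]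
  have sm2_m2 := stuffle_value [-2] [-2] [[-2, -2], [-2, -2], [4]]
  have sm2_2 := stuffle_value [-2] [2] [[-2, 2], [2, -2], [-4]]
  simp only [List.map_cons, List.map_nil, List.sum_cons, List.sum_nil, add_zero] at *
  -- The coefficients eliminate the remaining nested sums of weight four; relations of lower weight
  -- enter multiplied by values that complete the weight.
  linear_combination 4 * hL - (4 * mzv [-1, 1] + 23 / 6 * mzv [-2] -
    7 / 12 * mzv [2]) * mzv_neg_two - 2 * mzv [-1] * mzv_neg_three + mzv_neg_four +
    2 / 3 * wm11_m11 + 2 * wm1_m12 + (1 / 3 * mzv [-1, 1] + 1 / 6 * mzv [-1] * mzv [-1] -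
    2 * mzv [-2] - mzv [2]) * wm1_m1 + 2 / 3 * wm1_m2m1 + 4 / 3 * wm1_m21 + 2 / 3 * wm1_2m1 +
    4 / 3 * wm1_21 - 2 * mzv [-1] * wm1_2 - 4 * wm1_3 + 4 / 3 * wm2_m2 + 1 / 3 * wm2_2 +
    1 / 3 * w2_2 - 2 / 3 * sm1_m2m1 - 4 / 3 * sm1_m21 + 2 * mzv [-1] * sm1_m2 + 4 * sm1_m3 -
    2 / 3 * sm1_2m1 - 4 / 3 * sm1_21 + 2 * mzv [-1] * sm1_2 + 4 * sm1_3 + 5 / 2 * sm2_m2 + sm2_2 -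
    5 / 8 * mzv_two_mul_two

/-! ### Nested sums with weak inequalities -/

/-- The strict compositions into which `c`, followed weakly by each composition of a list,
decomposes. -/
def weakCons (c : ℤ) (l : List (List ℤ)) : List (List ℤ) :=
  l.flatMap fun
    | [] => [[c]]
    | a :: u => [c :: a :: u, mergeExp c a :: u]

/-- The inner sums run up to the outer index inclusively: their largest index is either strictly
smaller, giving `c :: a :: u`, or equal to it, giving the merged exponent. -/
theorem sum_signedTerm_mul_nestedSum (c : ℤ) (l : List (List ℤ)) (N : ℕ) :
    ∑ n ∈ range N, signedTerm c (n + 1) * (l.map fun s => nestedSum s (n + 1)).sum =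
      ((weakCons c l).map fun s => nestedSum s N).sum := by
  induction l with
  | nil => simp [weakCons]
  | cons s l ih =>
    simp only [weakCons, List.flatMap_cons, List.map_append, List.sum_append] at ih ⊢
    simp only [List.map_cons, List.sum_cons, mul_add, sum_add_distrib, ih]
    congr 1
    rcases s with _ | ⟨a, u⟩
    · simp [nestedSum]
    · simp only [nestedSum_cons_succ, mul_add, ← mul_assoc, signedTerm_mul, sum_add_distrib]
      simp [nestedSum]

/-- The value of `∑ signedTerm c n * nestedSum u n * nestedSum v n`. -/
def eulerSum (c : ℤ) (u v : List ℤ) : ℝ := ((weakCons c (stuffle u v)).map mzv).sum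

theorem eulerSum_eq (c : ℤ) (u v : List ℤ) (l : List (List ℤ))
    (h : weakCons c (stuffle u v) = l := by decide) : eulerSum c u v = (l.map mzv).sum := by
  rw [eulerSum, h]

theorem tendsto_eulerSum {c : ℤ} {u v : List ℤ}
    (h : ∀ s ∈ weakCons c (stuffle u v), Admissible s) :
    Tendsto (fun N => ∑ n ∈ range N,
      signedTerm c (n + 1) * (nestedSum u (n + 1) * nestedSum v (n + 1))) atTop
      (𝓝 (eulerSum c u v)) := by
  refine (tendsto_sum_map_nestedSum h).congr fun N => ?_
  simp only [← sum_signedTerm_mul_nestedSum, nestedSum_mul]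

/-- The five identities in the normalisation `(-1)^n`: every factor `L_n(k)`, every `(-1)^(n-1)` and
every `ln 2` contributes one change of sign. -/
theorem eulerSum_weight_six :
    (-eulerSum 2 [-1] [3] - eulerSum 3 [-1] [2] =
        3 / 4 * mzv [3] ^ 2 + 7 / 4 * mzv [6] - 5 / 8 * mzv [2] * mzv [3] * mzv [-1] -
          2 * mzv [2] * polylog 4 (1 / 2) + 5 / 4 * mzv [4] * mzv [-1] ^ 2 -
          1 / 12 * mzv [2] * mzv [-1] ^ 4) ∧
      (-eulerSum (-1) [2] [3] =
        -(161 / 64) * mzv [6] - 31 / 16 * mzv [5] * mzv [-1] + 9 / 32 * mzv [3] ^ 2 -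
          3 / 8 * mzv [2] * mzv [3] * mzv [-1] + 2 * mzv [2] * polylog 4 (1 / 2) -
          5 / 4 * mzv [4] * mzv [-1] ^ 2 + 1 / 12 * mzv [2] * mzv [-1] ^ 4 -
          eulerSum (-4) [2] [] + eulerSum 3 [-3] []) ∧
      (-eulerSum (-2) [-1] [-3] - eulerSum (-3) [-1] [-2] =
        -(385 / 128) * mzv [6] - 31 / 8 * mzv [5] * mzv [-1] + 3 / 32 * mzv [3] ^ 2 -
          9 / 8 * mzv [2] * mzv [3] * mzv [-1] + mzv [2] * polylog 4 (1 / 2) -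
          5 / 8 * mzv [4] * mzv [-1] ^ 2 + 1 / 24 * mzv [2] * mzv [-1] ^ 4) ∧
      (-eulerSum (-1) [-2] [-3] =
        163 / 128 * mzv [6] + 31 / 16 * mzv [5] * mzv [-1] + 3 / 16 * mzv [3] ^ 2 +
          3 / 4 * mzv [2] * mzv [3] * mzv [-1] - mzv [2] * polylog 4 (1 / 2) +
          5 / 8 * mzv [4] * mzv [-1] ^ 2 - 1 / 24 * mzv [2] * mzv [-1] ^ 4 -
          eulerSum 4 [-2] [] - eulerSum 3 [-3] []) ∧
      (-eulerSum 2 [-1] [3] =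
        2079 / 128 * mzv [6] - 93 / 32 * mzv [5] * mzv [-1] - 5 / 16 * mzv [3] ^ 2 +
          3 * mzv [2] * mzv [3] * mzv [-1] - 2 * mzv [2] * polylog 4 (1 / 2) +
          5 / 4 * mzv [4] * mzv [-1] ^ 2 - 1 / 12 * mzv [2] * mzv [-1] ^ 4 +
          eulerSum (-5) [-1] [] + eulerSum 4 [-2] [] +
          4 * eulerSum (-4) [2] [] + 8 * eulerSum (-5) [1] []) := by
  have e2m13 := eulerSum_eq 2 [-1] [3] [[2, -1, 3], [-3, 3], [2, 3, -1], [5, -1], [2, -4], [-6]]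
  have e3m12 := eulerSum_eq 3 [-1] [2] [[3, -1, 2], [-4, 2], [3, 2, -1], [5, -1], [3, -3], [-6]]
  have em123 := eulerSum_eq (-1) [2] [3] [[-1, 2, 3], [-3, 3], [-1, 3, 2], [-4, 2], [-1, 5], [-6]]
  have em42 := eulerSum_eq (-4) [2] [] [[-4, 2], [-6]]
  have e3m3 := eulerSum_eq 3 [-3] [] [[3, -3], [-6]]
  have em2m1m3 := eulerSum_eq (-2) [-1] [-3] [[-2, -1, -3], [3, -3], [-2, -3, -1], [5, -1],
    [-2, 4], [-6]]
  have em3m1m2 := eulerSum_eq (-3) [-1] [-2] [[-3, -1, -2], [4, -2], [-3, -2, -1], [5, -1],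
    [-3, 3], [-6]]
  have em1m2m3 := eulerSum_eq (-1) [-2] [-3] [[-1, -2, -3], [3, -3], [-1, -3, -2], [4, -2],
    [-1, 5], [-6]]
  have e4m2 := eulerSum_eq 4 [-2] [] [[4, -2], [-6]]
  have em5m1 := eulerSum_eq (-5) [-1] [] [[-5, -1], [6]]
  have em51 := eulerSum_eq (-5) [1] [] [[-5, 1], [-6]]
  -- Relations from the divergent factor `[1]`, in weights three to six; only the last identity
  -- needs `r4` and `r5`.
  have rm2 := regularized_value (-2) [] [[-2, 1], [-3]] [[2, -1], [-2, -1]]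
  have rm3 := regularized_value (-3) [] [[-3, 1], [-4]] [[2, -2], [3, -1], [-3, -1]]
  have r4 := regularized_value (4) [] [[4, 1], [5]] [[2, 3], [3, 2], [4, 1], [4, 1]]
  have r5 := regularized_value (5) [] [[5, 1], [6]] [[2, 4], [3, 3], [4, 2], [5, 1], [5, 1]]
  have wm11_4 := shuffle_value [-1, 1] [4] [[-1, 1, -4], [-1, 2, -3], [-1, 3, -2], [-1, 4, -1],
    [-1, -4, -1], [-2, 1, -3], [-2, 2, -2], [-2, 3, -1], [-2, -3, -1], [-3, 1, -2], [-3, 2, -1],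
    [-3, -2, -1], [-4, 1, -1], [-4, -1, -1], [4, -1, 1]]
  have wm1_m1m4 := shuffle_value [-1] [-1, -4] [[-1, 1, -4], [-1, 1, -4], [-1, 2, -3], [-1, 3, -2],
    [-1, 4, -1], [-1, -4, -1]]
  have wm1_m14 := shuffle_value [-1] [-1, 4] [[-1, 1, 4], [-1, 1, 4], [-1, 2, 3], [-1, 3, 2],
    [-1, 4, 1], [-1, 4, 1]]
  have wm1_m1 := shuffle_value [-1] [-1] [[-1, 1], [-1, 1]]
  have wm1_m23 := shuffle_value [-1] [-2, 3] [[-1, 2, 3], [-2, 1, 3], [-2, 1, 3], [-2, 2, 2],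
    [-2, 3, 1], [-2, 3, 1]]
  have wm1_m2 := shuffle_value [-1] [-2] [[-1, 2], [-2, 1], [-2, 1]]
  have wm1_m32 := shuffle_value [-1] [-3, 2] [[-1, 3, 2], [-2, 2, 2], [-3, 1, 2], [-3, 1, 2],
    [-3, 2, 1], [-3, 2, 1]]
  have wm1_m3 := shuffle_value [-1] [-3] [[-1, 3], [-2, 2], [-3, 1], [-3, 1]]
  have wm1_m4m1 := shuffle_value [-1] [-4, -1] [[-1, 4, -1], [-2, 3, -1], [-3, 2, -1], [-4, 1, -1],
    [-4, 1, -1], [-4, -1, -1]]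
  have wm1_m4 := shuffle_value [-1] [-4] [[-1, 4], [-2, 3], [-3, 2], [-4, 1], [-4, 1]]
  have wm1_m5 := shuffle_value [-1] [-5] [[-1, 5], [-2, 4], [-3, 3], [-4, 2], [-5, 1], [-5, 1]]
  have wm1_2m3 := shuffle_value [-1] [2, -3] [[-1, -2, -3], [-2, -1, -3], [2, -1, 3], [2, -2, 2],
    [2, -3, 1], [2, -3, 1]]
  have wm1_23 := shuffle_value [-1] [2, 3] [[-1, -2, 3], [-2, -1, 3], [2, -1, -3], [2, -2, -2],
    [2, -3, -1], [2, 3, -1]]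
  have wm1_2 := shuffle_value [-1] [2] [[-1, -2], [-2, -1], [2, -1]]
  have wm1_3m2 := shuffle_value [-1] [3, -2] [[-1, -3, -2], [-2, -2, -2], [-3, -1, -2], [3, -1, 2],
    [3, -2, 1], [3, -2, 1]]
  have wm1_32 := shuffle_value [-1] [3, 2] [[-1, -3, 2], [-2, -2, 2], [-3, -1, 2], [3, -1, -2],
    [3, -2, -1], [3, 2, -1]]
  have wm1_3 := shuffle_value [-1] [3] [[-1, -3], [-2, -2], [-3, -1], [3, -1]]
  have wm1_4m1 := shuffle_value [-1] [4, -1] [[-1, -4, -1], [-2, -3, -1], [-3, -2, -1],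
    [-4, -1, -1], [4, -1, 1], [4, -1, 1]]
  have wm1_41 := shuffle_value [-1] [4, 1] [[-1, -4, 1], [-2, -3, 1], [-3, -2, 1], [-4, -1, 1],
    [4, -1, -1], [4, 1, -1]]
  have wm1_4 := shuffle_value [-1] [4] [[-1, -4], [-2, -3], [-3, -2], [-4, -1], [4, -1]]
  have wm1_5 := shuffle_value [-1] [5] [[-1, -5], [-2, -4], [-3, -3], [-4, -2], [-5, -1], [5, -1]]
  have wm2_m13 := shuffle_value [-2] [-1, 3] [[-2, 1, 3], [-2, 1, 3], [-2, 2, 2], [-2, 3, 1],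
    [-2, 3, 1], [-1, 2, 3], [-1, 3, 2], [-1, 4, 1], [-1, 4, 1], [-1, 3, 2], [-1, 4, 1], [-1, 4, 1],
    [-1, 4, 1], [-1, 4, 1], [-1, 3, 2]]
  have wm2_m2m2 := shuffle_value [-2] [-2, -2] [[-2, 2, -2], [-3, 1, -2], [-3, 1, -2], [-3, 2, -1],
    [-3, -2, -1], [-3, 1, -2], [-3, 1, -2], [-3, 2, -1], [-3, -2, -1], [-2, 2, -2], [-2, 3, -1],
    [-2, -3, -1], [-2, 3, -1], [-2, -3, -1], [-2, -2, -2]]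
  have wm2_m2 := shuffle_value [-2] [-2] [[-2, 2], [-3, 1], [-3, 1], [-3, 1], [-3, 1], [-2, 2]]
  have wm2_m3 := shuffle_value [-2] [-3] [[-2, 3], [-3, 2], [-4, 1], [-4, 1], [-3, 2], [-4, 1],
    [-4, 1], [-4, 1], [-4, 1], [-3, 2]]
  have wm2_m4 := shuffle_value [-2] [-4] [[-2, 4], [-3, 3], [-4, 2], [-5, 1], [-5, 1], [-3, 3],
    [-4, 2], [-5, 1], [-5, 1], [-4, 2], [-5, 1], [-5, 1], [-5, 1], [-5, 1], [-4, 2]]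
  have wm2_2 := shuffle_value [-2] [2] [[-2, -2], [-3, -1], [3, -1], [-3, -1], [3, -1], [2, -2]]
  have wm2_3 := shuffle_value [-2] [3] [[-2, -3], [-3, -2], [-4, -1], [4, -1], [-3, -2], [-4, -1],
    [4, -1], [-4, -1], [4, -1], [3, -2]]
  have wm2_4 := shuffle_value [-2] [4] [[-2, -4], [-3, -3], [-4, -2], [-5, -1], [5, -1], [-3, -3],
    [-4, -2], [-5, -1], [5, -1], [-4, -2], [-5, -1], [5, -1], [-5, -1], [5, -1], [4, -2]]
  have w2_m3 := shuffle_value [2] [-3] [[2, -3], [3, -2], [4, -1], [-4, -1], [3, -2], [4, -1],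
    [-4, -1], [4, -1], [-4, -1], [-3, -2]]
  have w2_m4 := shuffle_value [2] [-4] [[2, -4], [3, -3], [4, -2], [5, -1], [-5, -1], [3, -3],
    [4, -2], [5, -1], [-5, -1], [4, -2], [5, -1], [-5, -1], [5, -1], [-5, -1], [-4, -2]]
  have w2_3 := shuffle_value [2] [3] [[2, 3], [3, 2], [4, 1], [4, 1], [3, 2], [4, 1], [4, 1],
    [4, 1], [4, 1], [3, 2]]
  have sm1m1_4 := stuffle_value [-1, -1] [4] [[-1, -1, 4], [-1, 4, -1], [-1, -5], [4, -1, -1],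
    [-5, -1]]
  have sm1m2_3 := stuffle_value [-1, -2] [3] [[-1, -2, 3], [-1, 3, -2], [-1, -5], [3, -1, -2],
    [-4, -2]]
  have sm11_m4 := stuffle_value [-1, 1] [-4] [[-1, 1, -4], [-1, -4, 1], [-1, -5], [-4, -1, 1],
    [5, 1]]
  have sm11_4 := stuffle_value [-1, 1] [4] [[-1, 1, 4], [-1, 4, 1], [-1, 5], [4, -1, 1], [-5, 1]]
  have sm12_3 := stuffle_value [-1, 2] [3] [[-1, 2, 3], [-1, 3, 2], [-1, 5], [3, -1, 2], [-4, 2]]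
  have sm1_m14 := stuffle_value [-1] [-1, 4] [[-1, -1, 4], [-1, -1, 4], [-1, 4, -1], [-1, -5],
    [2, 4]]
  have sm1_m1 := stuffle_value [-1] [-1] [[-1, -1], [-1, -1], [2]]
  have sm1_m2 := stuffle_value [-1] [-2] [[-1, -2], [-2, -1], [3]]
  have sm1_m32 := stuffle_value [-1] [-3, 2] [[-1, -3, 2], [-3, -1, 2], [-3, 2, -1], [-3, -3],
    [4, 2]]
  have sm1_m3 := stuffle_value [-1] [-3] [[-1, -3], [-3, -1], [4]]
  have sm1_m4m1 := stuffle_value [-1] [-4, -1] [[-1, -4, -1], [-4, -1, -1], [-4, -1, -1], [-4, 2],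
    [5, -1]]
  have sm1_m41 := stuffle_value [-1] [-4, 1] [[-1, -4, 1], [-4, -1, 1], [-4, 1, -1], [-4, -2],
    [5, 1]]
  have sm1_m4 := stuffle_value [-1] [-4] [[-1, -4], [-4, -1], [5]]
  have sm1_m5 := stuffle_value [-1] [-5] [[-1, -5], [-5, -1], [6]]
  have sm1_23 := stuffle_value [-1] [2, 3] [[-1, 2, 3], [2, -1, 3], [2, 3, -1], [2, -4], [-3, 3]]
  have sm1_2 := stuffle_value [-1] [2] [[-1, 2], [2, -1], [-3]]
  have sm1_3m2 := stuffle_value [-1] [3, -2] [[-1, 3, -2], [3, -1, -2], [3, -2, -1], [3, 3],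
    [-4, -2]]
  have sm1_32 := stuffle_value [-1] [3, 2] [[-1, 3, 2], [3, -1, 2], [3, 2, -1], [3, -3], [-4, 2]]
  have sm1_3 := stuffle_value [-1] [3] [[-1, 3], [3, -1], [-4]]
  have sm1_41 := stuffle_value [-1] [4, 1] [[-1, 4, 1], [4, -1, 1], [4, 1, -1], [4, -2], [-5, 1]]
  have sm1_4 := stuffle_value [-1] [4] [[-1, 4], [4, -1], [-5]]
  have sm2m1_3 := stuffle_value [-2, -1] [3] [[-2, -1, 3], [-2, 3, -1], [-2, -4], [3, -2, -1],
    [-5, -1]]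
  have sm21_3 := stuffle_value [-2, 1] [3] [[-2, 1, 3], [-2, 3, 1], [-2, 4], [3, -2, 1], [-5, 1]]
  have sm2_m1m3 := stuffle_value [-2] [-1, -3] [[-2, -1, -3], [-1, -2, -3], [-1, -3, -2], [-1, 5],
    [3, -3]]
  have sm2_m2m2 := stuffle_value [-2] [-2, -2] [[-2, -2, -2], [-2, -2, -2], [-2, -2, -2], [-2, 4],
    [4, -2]]
  have sm2_m22 := stuffle_value [-2] [-2, 2] [[-2, -2, 2], [-2, -2, 2], [-2, 2, -2], [-2, -4],
    [4, 2]]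
  have sm2_m2 := stuffle_value [-2] [-2] [[-2, -2], [-2, -2], [4]]
  have sm2_m31 := stuffle_value [-2] [-3, 1] [[-2, -3, 1], [-3, -2, 1], [-3, 1, -2], [-3, -3],
    [5, 1]]
  have sm2_m4 := stuffle_value [-2] [-4] [[-2, -4], [-4, -2], [6]]
  have sm2_2m2 := stuffle_value [-2] [2, -2] [[-2, 2, -2], [2, -2, -2], [2, -2, -2], [2, 4],
    [-4, -2]]
  have sm2_2 := stuffle_value [-2] [2] [[-2, 2], [2, -2], [-4]]
  have sm2_3m1 := stuffle_value [-2] [3, -1] [[-2, 3, -1], [3, -2, -1], [3, -1, -2], [3, 3],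
    [-5, -1]]
  have sm2_3 := stuffle_value [-2] [3] [[-2, 3], [3, -2], [-5]]
  have sm2_4 := stuffle_value [-2] [4] [[-2, 4], [4, -2], [-6]]
  have sm3_m1m2 := stuffle_value [-3] [-1, -2] [[-3, -1, -2], [-1, -3, -2], [-1, -2, -3], [-1, 5],
    [4, -2]]
  have sm3_m12 := stuffle_value [-3] [-1, 2] [[-3, -1, 2], [-1, -3, 2], [-1, 2, -3], [-1, -5],
    [4, 2]]
  have sm3_m2m1 := stuffle_value [-3] [-2, -1] [[-3, -2, -1], [-2, -3, -1], [-2, -1, -3], [-2, 4],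
    [5, -1]]
  have sm3_m21 := stuffle_value [-3] [-2, 1] [[-3, -2, 1], [-2, -3, 1], [-2, 1, -3], [-2, -4],
    [5, 1]]
  have sm3_m3 := stuffle_value [-3] [-3] [[-3, -3], [-3, -3], [6]]
  have sm3_2m1 := stuffle_value [-3] [2, -1] [[-3, 2, -1], [2, -3, -1], [2, -1, -3], [2, 4],
    [-5, -1]]
  have sm3_3 := stuffle_value [-3] [3] [[-3, 3], [3, -3], [-6]]
  have s2m1_3 := stuffle_value [2, -1] [3] [[2, -1, 3], [2, 3, -1], [2, -4], [3, 2, -1], [5, -1]]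
  have s2_m13 := stuffle_value [2] [-1, 3] [[2, -1, 3], [-1, 2, 3], [-1, 3, 2], [-1, 5], [-3, 3]]
  have s2_m2m2 := stuffle_value [2] [-2, -2] [[2, -2, -2], [-2, 2, -2], [-2, -2, 2], [-2, -4],
    [-4, -2]]
  have s2_m22 := stuffle_value [2] [-2, 2] [[2, -2, 2], [-2, 2, 2], [-2, 2, 2], [-2, 4], [-4, 2]]
  have s2_m31 := stuffle_value [2] [-3, 1] [[2, -3, 1], [-3, 2, 1], [-3, 1, 2], [-3, 3], [-5, 1]]
  have s2_m3 := stuffle_value [2] [-3] [[2, -3], [-3, 2], [-5]]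
  have s2_m4 := stuffle_value [2] [-4] [[2, -4], [-4, 2], [-6]]
  have s2_3 := stuffle_value [2] [3] [[2, 3], [3, 2], [5]]
  have s3_3 := stuffle_value [3] [3] [[3, 3], [3, 3], [6]]
  simp only [List.map_cons, List.map_nil, List.sum_cons, List.sum_nil, add_zero] at *
  refine ⟨?_, ?_, ?_, ?_, ?_⟩
  -- Each identity is a rational combination of relations made homogeneous of weight six. The
  -- multiple of `polylog_four_half` is fixed by the coefficient of `mzv [2] * polylog 4 (1 / 2)` in
  -- the identity.
  · linear_combination -e2m13 - e3m12 + (5 / 3 * mzv [-1, -3] + 4 / 3 * mzv [-1, 3] +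
      13 / 4 * mzv [-1] * mzv [3] + 5 / 6 * mzv [-2, -2] + 1 / 6 * mzv [-2, 2] + 4 * mzv [-3, 1] +
      20 / 3 * mzv [-4] - 5 / 3 * mzv [2, -2] + 16 / 15 * mzv [2] * mzv [2] -
      2 / 3 * mzv [3, -1]) * mzv_neg_two + (mzv [-1, -2] - mzv [-1, 2] - mzv [-1] * mzv [2] +
      mzv [-2, -1] - 2 * mzv [-2, 1] - 3 * mzv [-2] * mzv [-1]) * mzv_neg_three -
      49 / 12 * mzv [2] * mzv_neg_four - 11 / 6 * mzv_neg_six - 5 / 3 * mzv [-2] * rm3 -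
      2 * wm11_4 + wm1_m1m4 - mzv [4] * wm1_m1 + wm1_m23 - 7 / 4 * mzv [3] * wm1_m2 + wm1_m32 +
      4 / 3 * mzv [-2] * wm1_m3 + wm1_m4m1 + 4 * wm1_m5 + wm1_2m3 + wm1_3m2 +
      5 / 6 * mzv [2] * wm1_3 + wm1_4m1 + mzv [-1] * wm1_4 + 2 * wm1_5 + wm2_m2m2 -
      7 / 12 * mzv [-2] * wm2_m2 - 1 / 2 * wm2_m4 - 5 / 12 * mzv [2] * wm2_2 - mzv [-1] * wm2_3 +
      1 / 2 * wm2_4 + mzv [-1] * w2_m3 - 2 * sm12_3 + 3 / 4 * mzv [3] * sm1_m2 - sm1_m32 +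
      5 / 3 * mzv [-2] * sm1_m3 - 3 * sm1_m5 + 2 * sm1_23 - mzv [3] * sm1_2 + sm1_3m2 +
      2 * sm1_32 - 1 / 3 * mzv [2] * sm1_3 - 2 * sm21_3 - 2 / 3 * sm2_m2m2 +
      7 / 12 * mzv [-2] * sm2_m2 - 2 * sm2_m31 - 9 / 2 * sm2_m4 - 5 / 12 * mzv [2] * sm2_2 -
      sm2_3m1 + mzv [-1] * sm2_3 + 7 / 6 * sm2_4 - sm3_m1m2 + sm3_m12 - sm3_m2m1 + 2 * sm3_m21 -
      sm3_3 - s2m1_3 - s2_m13 - s2_m22 - 2 * s2_m31 + 2 * mzv [-1] * s2_3 +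
      1 / 2 * mzv [2] * polylog_four_half + (1 / 2 * mzv [-1] * mzv [-1] - 7 / 30 * mzv [-2] -
      8 / 15 * mzv [2]) * mzv_two_mul_two + 205 / 48 * mzv_two_mul_four
  · linear_combination -em123 + em42 - e3m3 - (5 / 3 * mzv [-1, -3] + 4 / 3 * mzv [-1, 3] +
      13 / 4 * mzv [-1] * mzv [3] + 5 / 6 * mzv [-2, -2] + 1 / 6 * mzv [-2, 2] + 4 * mzv [-3, 1] +
      17 / 3 * mzv [-4] - 5 / 3 * mzv [2, -2] + 16 / 15 * mzv [2] * mzv [2] -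
      2 / 3 * mzv [3, -1]) * mzv_neg_two + (3 / 8 * mzv [-1, -2] + mzv [-1, 2] +
      mzv [-1] * mzv [2] + 3 / 8 * mzv [-2, -1] + 2 * mzv [-2, 1] + 13 / 8 * mzv [-2] * mzv [-1] +
      1 / 2 * mzv [-3]) * mzv_neg_three + 43 / 12 * mzv [2] * mzv_neg_four +
      mzv [-1] * mzv_neg_five + 5 / 6 * mzv_neg_six + 5 / 3 * mzv [-2] * rm3 + 2 * wm11_4 -
      wm1_m1m4 + mzv [4] * wm1_m1 - wm1_m23 + 7 / 4 * mzv [3] * wm1_m2 - wm1_m32 -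
      4 / 3 * mzv [-2] * wm1_m3 - wm1_m4m1 - 4 * wm1_m5 - wm1_2m3 - wm1_3m2 -
      5 / 6 * mzv [2] * wm1_3 - wm1_4m1 - mzv [-1] * wm1_4 - wm1_5 - wm2_m2m2 +
      7 / 12 * mzv [-2] * wm2_m2 + 1 / 2 * wm2_m4 + 5 / 12 * mzv [2] * wm2_2 + mzv [-1] * wm2_3 -
      1 / 2 * wm2_4 - mzv [-1] * w2_m3 + 3 * sm12_3 + (11 / 8 * mzv [-3] +
      9 / 32 * mzv [3]) * sm1_m2 + sm1_m32 - 5 / 3 * mzv [-2] * sm1_m3 + 2 * sm1_m5 - 2 * sm1_23 +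
      2 * mzv [3] * sm1_2 - sm1_3m2 - 2 * sm1_32 + 1 / 3 * mzv [2] * sm1_3 + 2 * sm21_3 +
      2 / 3 * sm2_m2m2 - 7 / 12 * mzv [-2] * sm2_m2 + 2 * sm2_m31 + 7 / 2 * sm2_m4 +
      5 / 12 * mzv [2] * sm2_2 + sm2_3m1 - mzv [-1] * sm2_3 - 7 / 6 * sm2_4 + sm3_m1m2 - sm3_m12 +
      sm3_m2m1 - 2 * sm3_m21 - 1 / 2 * sm3_m3 + 3 * sm3_3 + 2 * s2m1_3 + s2_m13 + s2_m22 +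
      2 * s2_m31 - 2 * mzv [-1] * s2_3 - 1 / 2 * mzv [2] * polylog_four_half -
      (1 / 2 * mzv [-1] * mzv [-1] - 7 / 30 * mzv [-2] - 8 / 15 * mzv [2]) * mzv_two_mul_two -
      23 / 6 * mzv_two_mul_four
  · linear_combination -em2m1m3 - em3m1m2 - (5 / 6 * mzv [-1, -3] - 5 / 6 * mzv [-1, 3] +
      mzv [-1] * mzv [3] + 5 / 12 * mzv [-2, -2] - 23 / 12 * mzv [-2, 2] + 29 / 6 * mzv [-4] -
      11 / 6 * mzv [2, -2] + 26 / 15 * mzv [2] * mzv [2] - 5 / 6 * mzv [3, -1]) * mzv_neg_two +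
      (1 / 8 * mzv [-1, -2] + mzv [-1, 2] + 1 / 2 * mzv [-1] * mzv [2] + 1 / 8 * mzv [-2, -1] +
      mzv [-2, 1] - 5 / 8 * mzv [-2] * mzv [-1] + 1 / 2 * mzv [2, -1]) * mzv_neg_three +
      85 / 24 * mzv [2] * mzv_neg_four + 2 * mzv [-1] * mzv_neg_five + 13 / 6 * mzv_neg_six +
      mzv [-3] * rm2 + 11 / 6 * mzv [-2] * rm3 + 2 * wm11_4 - wm1_m1m4 + mzv [4] * wm1_m1 +
      3 / 8 * mzv [3] * wm1_m2 + 5 / 6 * mzv [-2] * wm1_m3 - wm1_m4m1 - 2 * wm1_m5 -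
      1 / 2 * mzv [-3] * wm1_2 - 5 / 12 * mzv [2] * wm1_3 - wm1_4m1 - mzv [-1] * wm1_4 - wm2_m2m2 +
      13 / 24 * mzv [-2] * wm2_m2 + 1 / 2 * wm2_m4 + 5 / 24 * mzv [2] * wm2_2 + mzv [-1] * wm2_3 -
      1 / 2 * wm2_4 - mzv [-1] * w2_m3 + 2 * sm12_3 + (13 / 8 * mzv [-3] +
      3 / 32 * mzv [3]) * sm1_m2 + sm1_m32 - 11 / 6 * mzv [-2] * sm1_m3 + sm1_m5 - 2 * sm1_23 +
      19 / 8 * mzv [3] * sm1_2 - sm1_3m2 - 2 * sm1_32 + 5 / 12 * mzv [2] * sm1_3 - sm2_m1m3 +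
      1 / 3 * sm2_m2m2 - 13 / 24 * mzv [-2] * sm2_m2 + 2 * sm2_m31 + 5 / 2 * sm2_m4 +
      17 / 24 * mzv [2] * sm2_2 + sm2_3m1 + 1 / 6 * sm2_4 + sm3_m1m2 - sm3_m12 + 2 * sm3_m2m1 -
      2 * sm3_m21 - sm3_m3 + 4 * sm3_3 + 2 * s2m1_3 + mzv [-1] * s2_m3 - 2 * mzv [-1] * s2_3 -
      1 / 4 * mzv [2] * polylog_four_half - (1 / 4 * mzv [-1] * mzv [-1] - 49 / 60 * mzv [-2] -
      13 / 15 * mzv [2]) * mzv_two_mul_two - 187 / 96 * mzv_two_mul_four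
  · linear_combination -em1m2m3 + e4m2 + e3m3 + (5 / 6 * mzv [-1, -3] - 5 / 6 * mzv [-1, 3] +
      7 / 4 * mzv [-1] * mzv [3] + 5 / 12 * mzv [-2, -2] - 23 / 12 * mzv [-2, 2] +
      35 / 6 * mzv [-4] - 11 / 6 * mzv [2, -2] + 26 / 15 * mzv [2] * mzv [2] -
      5 / 6 * mzv [3, -1]) * mzv_neg_two + (1 / 4 * mzv [-1, -2] - mzv [-1, 2] -
      1 / 2 * mzv [-1] * mzv [2] + 1 / 4 * mzv [-2, -1] - mzv [-2, 1] -
      3 / 4 * mzv [-2] * mzv [-1] + 1 / 2 * mzv [-3] - 1 / 2 * mzv [2, -1]) * mzv_neg_three -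
      97 / 24 * mzv [2] * mzv_neg_four - mzv [-1] * mzv_neg_five - 13 / 6 * mzv_neg_six -
      mzv [-3] * rm2 - 11 / 6 * mzv [-2] * rm3 - 2 * wm11_4 + wm1_m1m4 - mzv [4] * wm1_m1 -
      3 / 8 * mzv [3] * wm1_m2 - 5 / 6 * mzv [-2] * wm1_m3 + wm1_m4m1 + 2 * wm1_m5 +
      1 / 2 * mzv [-3] * wm1_2 + 5 / 12 * mzv [2] * wm1_3 + wm1_4m1 + mzv [-1] * wm1_4 + wm1_5 +
      wm2_m2m2 - 13 / 24 * mzv [-2] * wm2_m2 - 1 / 2 * wm2_m4 - 5 / 24 * mzv [2] * wm2_2 -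
      mzv [-1] * wm2_3 + 1 / 2 * wm2_4 + mzv [-1] * w2_m3 - 2 * sm12_3 - (1 / 4 * mzv [-3] -
      3 / 16 * mzv [3]) * sm1_m2 - sm1_m32 + 11 / 6 * mzv [-2] * sm1_m3 - 2 * sm1_m5 + 2 * sm1_23 -
      19 / 8 * mzv [3] * sm1_2 + sm1_3m2 + 2 * sm1_32 - 5 / 12 * mzv [2] * sm1_3 + sm2_m1m3 -
      1 / 3 * sm2_m2m2 + 13 / 24 * mzv [-2] * sm2_m2 - 2 * sm2_m31 - 7 / 2 * sm2_m4 -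
      17 / 24 * mzv [2] * sm2_2 - sm2_3m1 - 1 / 6 * sm2_4 + sm3_m12 - sm3_m2m1 + 2 * sm3_m21 +
      1 / 2 * sm3_m3 - 3 * sm3_3 - 2 * s2m1_3 - mzv [-1] * s2_m3 + 2 * mzv [-1] * s2_3 +
      1 / 4 * mzv [2] * polylog_four_half + (1 / 4 * mzv [-1] * mzv [-1] - 49 / 60 * mzv [-2] -
      13 / 15 * mzv [2]) * mzv_two_mul_two + 229 / 96 * mzv_two_mul_four
  · linear_combination -e2m13 - em5m1 - e4m2 - 4 * em42 - 8 * em51 + (71 / 15 * mzv [-1, -3] -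
      361 / 30 * mzv [-1, 3] - 11 / 4 * mzv [-1] * mzv [3] - 29 / 6 * mzv [-2, -2] -
      37 / 6 * mzv [-2, 2] - 10 * mzv [-3, 1] + 77 / 15 * mzv [-4] - 38 / 15 * mzv [2, -2] +
      166 / 75 * mzv [2] * mzv [2] - 163 / 30 * mzv [3, -1]) * mzv_neg_two -
      (73 / 60 * mzv [-1, -2] - 11 / 10 * mzv [-1, 2] - 22 / 15 * mzv [-1] * mzv [2] +
      73 / 60 * mzv [-2, -1] + 2 / 5 * mzv [-2, 1] - 131 / 20 * mzv [-2] * mzv [-1] -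
      3 / 10 * mzv [-3] - 11 / 6 * mzv [2, -1]) * mzv_neg_three + (48 / 35 * mzv [-1, -1] +
      13 / 5 * mzv [-1, 1] - 139 / 70 * mzv [-1] * mzv [-1] -
      1151 / 210 * mzv [2]) * mzv_neg_four + 3 / 2 * mzv [-1] * mzv_neg_five -
      413 / 30 * mzv_neg_six - 71 / 15 * mzv [-2] * rm3 + 3 * mzv [-1] * r4 + 12 / 5 * r5 -
      2 / 5 * wm11_4 + 3 / 2 * wm1_m1m4 - 39 / 10 * wm1_m14 + 387 / 80 * mzv [4] * wm1_m1 -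
      27 / 10 * wm1_m23 + 47 / 20 * mzv [3] * wm1_m2 - 5 / 2 * wm1_m32 -
      71 / 6 * mzv [-2] * wm1_m3 - 1 / 2 * wm1_m4m1 - 1 / 5 * mzv [-1] * wm1_m4 - 27 / 2 * wm1_m5 -
      5 / 2 * wm1_2m3 + 4 / 5 * wm1_23 + 31 / 30 * mzv [-3] * wm1_2 - 5 / 2 * wm1_3m2 +
      2 / 5 * wm1_32 + 71 / 30 * mzv [2] * wm1_3 - 31 / 10 * wm1_4m1 + 6 / 5 * wm1_41 +
      3 / 2 * wm1_5 + 1 / 5 * wm2_m13 + 1 / 2 * wm2_m2m2 + 11 / 6 * mzv [-2] * wm2_m2 +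
      3 / 10 * mzv [-1] * wm2_m3 + 23 / 10 * wm2_m4 - 71 / 60 * mzv [2] * wm2_2 - 1 / 2 * w2_m4 -
      1 / 2 * mzv [-1] * w2_3 - 6 / 5 * sm1m1_4 - 4 / 5 * sm1m2_3 - 13 / 5 * sm11_m4 +
      39 / 5 * sm11_4 - 1 / 10 * sm12_3 + 3 / 5 * sm1_m14 + 24 / 35 * mzv [-4] * sm1_m1 +
      (1 / 4 * mzv [-3] - 137 / 80 * mzv [3]) * sm1_m2 + 7 / 10 * sm1_m32 +
      71 / 15 * mzv [-2] * sm1_m3 + 2 * sm1_m4m1 + 7 / 5 * sm1_m41 + 3 / 2 * mzv [-1] * sm1_m4 +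
      18 / 5 * sm1_m5 + 16 / 5 * sm1_23 - 13 / 8 * mzv [3] * sm1_2 - 3 / 10 * sm1_3m2 +
      13 / 5 * sm1_32 - 163 / 60 * mzv [2] * sm1_3 - 6 / 5 * sm1_41 - 31 / 10 * mzv [-1] * sm1_4 -
      4 / 5 * sm2m1_3 + 5 * sm21_3 + 2 / 3 * sm2_m2m2 - 2 * sm2_m22 - 11 / 6 * mzv [-2] * sm2_m2 -
      8 / 5 * sm2_m31 - 27 / 10 * sm2_m4 - 11 / 5 * sm2_2m2 - 1 / 12 * mzv [2] * sm2_2 +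
      7 / 10 * sm2_3m1 - 14 / 5 * mzv [-1] * sm2_3 + 8 / 15 * sm2_4 + 5 / 2 * sm3_m1m2 -
      11 / 10 * sm3_m12 + 5 / 2 * sm3_m2m1 + 2 / 5 * sm3_m21 - 3 / 10 * sm3_m3 - 4 / 5 * sm3_2m1 -
      8 / 5 * sm3_3 - 3 * s2m1_3 + 33 / 10 * s2_m13 + 18 / 5 * s2_m2m2 + 5 / 2 * s2_m22 +
      5 * s2_m31 - 5 / 2 * mzv [-1] * s2_m3 + 13 / 10 * s2_m4 + 3 / 2 * mzv [-1] * s2_3 -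
      7 / 5 * s3_3 + 1 / 2 * mzv [2] * polylog_four_half + (1 / 2 * mzv [-1] * mzv [-1] -
      71 / 75 * mzv [-2] - 83 / 75 * mzv [2]) * mzv_two_mul_two + 1949 / 480 * mzv_two_mul_four

/-! ### From the series of the statement to nested sums -/

theorem sum_Icc_one (f : ℕ → ℝ) (N : ℕ) : ∑ n ∈ Icc 1 N, f n = ∑ n ∈ range N, f (n + 1) := by
  induction N with
  | zero => simp
  | succ N ih => rw [sum_Icc_succ_top (by omega), sum_range_succ, ih]

theorem zetaN_eq (n : ℕ) {k : ℕ} (hk : k ≠ 0) : zetaN n k = nestedSum [(k : ℤ)] n := by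
  rw [zetaN, sum_Icc_one, nestedSum_singleton _ _ hk]
  simp

theorem altN_eq (n : ℕ) {k : ℕ} (hk : k ≠ 0) : altN n k = -nestedSum [-(k : ℤ)] n := by
  rw [altN, sum_Icc_one, nestedSum_singleton_neg _ _ hk, ← sum_neg_distrib]
  refine sum_congr rfl fun m _ => ?_
  rw [Nat.add_sub_cancel, pow_succ]
  push_cast
  ring

theorem signedTerm_natCast {k : ℕ} (hk : k ≠ 0) (n : ℕ) :
    signedTerm (k : ℤ) (n + 1) = 1 / ((n + 1 : ℕ) : ℝ) ^ k := by
  simp [signedTerm, Int.sign_eq_one_of_pos (by omega : (0 : ℤ) < k)]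

theorem signedTerm_neg_natCast {k : ℕ} (hk : k ≠ 0) (n : ℕ) :
    signedTerm (-(k : ℤ)) (n + 1) = -((-1) ^ n / ((n + 1 : ℕ) : ℝ) ^ k) := by
  rw [signedTerm, Int.sign_eq_neg_one_of_neg (by omega), Int.natAbs_neg, Int.natAbs_natCast,
    pow_succ]
  push_cast
  ring

theorem SumsTo.of_eq_signedTerm {f : ℕ → ℝ} {c : ℤ} {u v : List ℤ} {e : ℝ}
    (hf : ∀ n, f (n + 1) =
      e * (signedTerm c (n + 1) * (nestedSum u (n + 1) * nestedSum v (n + 1))))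
    (h : ∀ s ∈ weakCons c (stuffle u v), Admissible s) : SumsTo f (e * eulerSum c u v) := by
  refine ((tendsto_eulerSum h).const_mul e).congr fun N => ?_
  rw [sum_Icc_one, mul_sum]
  exact sum_congr rfl fun n _ => (hf n).symm

/-- Two factors of size `√n` against `n^(-2)` would not suffice. Hence `v` is required to be
admissible, so that its sums are bounded, and only `u` is estimated by `√n`. -/
theorem AbsConv.of_eq_signedTerm {f : ℕ → ℝ} {c : ℤ} {u v : List ℤ} {e : ℝ}
    (hf : ∀ n, f (n + 1) =
      e * (signedTerm c (n + 1) * (nestedSum u (n + 1) * nestedSum v (n + 1))))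
    (hc : 2 ≤ c.natAbs) (hu : ∀ k ∈ u, k ≠ 0) (hv : Admissible v) : AbsConv f := by
  obtain ⟨C, hC⟩ := (tendsto_nestedSum hv).abs.bddAbove_range
  have hC' : ∀ n, |nestedSum v n| ≤ C := fun n => hC ⟨n, rfl⟩
  have hC0 : 0 ≤ C := (abs_nonneg _).trans (hC' 0)
  refine .of_nonneg_of_le (fun _ => abs_nonneg _) (fun n => ?_)
    (summable_inv_mul_sqrt.mul_left (|e| * (2 ^ u.length * 2 * C)))
  have hp : (0 : ℝ) < (n : ℝ) + 1 := by positivity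
  have h0 : √((n : ℝ) + 1) ≠ 0 := (Real.sqrt_pos.2 hp).ne'
  have hsq := Real.sq_sqrt hp.le
  have h1 : |nestedSum u (n + 1)| ≤ 2 ^ u.length * (2 * √((n : ℝ) + 1)) := by
    refine (abs_nestedSum_le hu (n + 1)).trans ?_
    gcongr
    refine Real.sqrt_le_iff.2 ⟨by positivity, ?_⟩
    rw [mul_pow, hsq]
    push_cast
    linarith
  rw [hf, abs_mul, abs_mul, abs_mul, mul_assoc |e|]
  refine mul_le_mul_of_nonneg_left ?_ (abs_nonneg e)
  calc _ ≤ 1 / ((n : ℝ) + 1) ^ 2 * (2 ^ u.length * (2 * √((n : ℝ) + 1)) * C) :=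
        mul_le_mul (abs_signedTerm_le_inv hc n)
          (mul_le_mul h1 (hC' _) (abs_nonneg _) (by positivity)) (by positivity) (by positivity)
    _ = _ := by
        field_simp
        rw [hsq]

theorem absSum_eq_of_sumsTo {f : ℕ → ℝ} {S : ℝ} (h : AbsConv f) (hS : SumsTo f S) :
    absSum f = S := by
  refine tendsto_nhds_unique h.of_abs.hasSum.tendsto_sum_nat (hS.congr fun N => ?_)
  rw [sum_Icc_one]

theorem absConv_and_absSum_eq {f : ℕ → ℝ} (c : ℤ) (u v : List ℤ) {e : ℝ}
    (hf : ∀ n, f (n + 1) =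
      e * (signedTerm c (n + 1) * (nestedSum u (n + 1) * nestedSum v (n + 1))))
    (h : (2 ≤ c.natAbs ∧ (∀ k ∈ u, k ≠ 0) ∧ Admissible v) ∧
      ∀ s ∈ weakCons c (stuffle u v), Admissible s := by decide) :
    AbsConv f ∧ absSum f = e * eulerSum c u v :=
  have hA := AbsConv.of_eq_signedTerm hf h.1.1 h.1.2.1 h.1.2.2
  ⟨hA, absSum_eq_of_sumsTo hA (.of_eq_signedTerm hf h.2)⟩

theorem harmonic_eq_nestedSum (n : ℕ) : (harmonic n : ℝ) = nestedSum [1] n := by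
  rw [nestedSum_one, harmonic]
  push_cast
  simp

end EulerSum

end

theorem mainTheorem12 :
    -- absolute convergence of the series of order at least two that occur below
    (EulerSum.AbsConv (fun n => EulerSum.altN n 1 * EulerSum.zetaN n 3 / (n : ℝ) ^ 2) ∧
     EulerSum.AbsConv (fun n => EulerSum.altN n 1 * EulerSum.zetaN n 2 / (n : ℝ) ^ 3) ∧
     EulerSum.AbsConv
      (fun n => EulerSum.altN n 1 * EulerSum.altN n 3 / (n : ℝ) ^ 2 * (-1) ^ (n - 1)) ∧
     EulerSum.AbsConv
      (fun n => EulerSum.altN n 1 * EulerSum.altN n 2 / (n : ℝ) ^ 3 * (-1) ^ (n - 1)) ∧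
     EulerSum.AbsConv (fun n => EulerSum.zetaN n 2 / (n : ℝ) ^ 4 * (-1) ^ (n - 1)) ∧
     EulerSum.AbsConv (fun n => EulerSum.altN n 3 / (n : ℝ) ^ 3) ∧
     EulerSum.AbsConv (fun n => EulerSum.altN n 2 / (n : ℝ) ^ 4) ∧
     EulerSum.AbsConv (fun n => EulerSum.altN n 1 / (n : ℝ) ^ 5 * (-1) ^ (n - 1)) ∧
     EulerSum.AbsConv (fun n => (harmonic n : ℝ) / (n : ℝ) ^ 5 * (-1) ^ (n - 1))) ∧
    -- `∑ L_n(1) ζ_n(3) / n^2 + ∑ L_n(1) ζ_n(2) / n^3`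
    (EulerSum.absSum (fun n => EulerSum.altN n 1 * EulerSum.zetaN n 3 / (n : ℝ) ^ 2) +
      EulerSum.absSum (fun n => EulerSum.altN n 1 * EulerSum.zetaN n 2 / (n : ℝ) ^ 3) =
      3 / 4 * EulerSum.zetaVal 3 ^ 2 + 7 / 4 * EulerSum.zetaVal 6
        + 5 / 8 * EulerSum.zetaVal 2 * EulerSum.zetaVal 3 * Real.log 2
        - 2 * EulerSum.zetaVal 2 * EulerSum.polylog 4 (1 / 2)
        + 5 / 4 * EulerSum.zetaVal 4 * Real.log 2 ^ 2
        - 1 / 12 * EulerSum.zetaVal 2 * Real.log 2 ^ 4) ∧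
    -- `∑ ζ_n(2) ζ_n(3) (-1)^(n-1) / n`
    EulerSum.SumsTo
      (fun n => EulerSum.zetaN n 2 * EulerSum.zetaN n 3 / (n : ℝ) * (-1) ^ (n - 1))
      (-(161 / 64) * EulerSum.zetaVal 6 + 31 / 16 * EulerSum.zetaVal 5 * Real.log 2
        + 9 / 32 * EulerSum.zetaVal 3 ^ 2
        + 3 / 8 * EulerSum.zetaVal 2 * EulerSum.zetaVal 3 * Real.log 2
        + 2 * EulerSum.zetaVal 2 * EulerSum.polylog 4 (1 / 2)
        - 5 / 4 * EulerSum.zetaVal 4 * Real.log 2 ^ 2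
        + 1 / 12 * EulerSum.zetaVal 2 * Real.log 2 ^ 4
        + EulerSum.absSum (fun n => EulerSum.zetaN n 2 / (n : ℝ) ^ 4 * (-1) ^ (n - 1))
        - EulerSum.absSum (fun n => EulerSum.altN n 3 / (n : ℝ) ^ 3)) ∧
    -- `∑ L_n(1) L_n(3) (-1)^(n-1) / n^2 + ∑ L_n(1) L_n(2) (-1)^(n-1) / n^3`
    (EulerSum.absSum
        (fun n => EulerSum.altN n 1 * EulerSum.altN n 3 / (n : ℝ) ^ 2 * (-1) ^ (n - 1)) +
      EulerSum.absSum
        (fun n => EulerSum.altN n 1 * EulerSum.altN n 2 / (n : ℝ) ^ 3 * (-1) ^ (n - 1)) =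
      -(385 / 128) * EulerSum.zetaVal 6 + 31 / 8 * EulerSum.zetaVal 5 * Real.log 2
        + 3 / 32 * EulerSum.zetaVal 3 ^ 2
        + 9 / 8 * EulerSum.zetaVal 2 * EulerSum.zetaVal 3 * Real.log 2
        + EulerSum.zetaVal 2 * EulerSum.polylog 4 (1 / 2)
        - 5 / 8 * EulerSum.zetaVal 4 * Real.log 2 ^ 2
        + 1 / 24 * EulerSum.zetaVal 2 * Real.log 2 ^ 4) ∧
    -- `∑ L_n(2) L_n(3) (-1)^(n-1) / n`
    EulerSum.SumsTo
      (fun n => EulerSum.altN n 2 * EulerSum.altN n 3 / (n : ℝ) * (-1) ^ (n - 1))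
      (163 / 128 * EulerSum.zetaVal 6 - 31 / 16 * EulerSum.zetaVal 5 * Real.log 2
        + 3 / 16 * EulerSum.zetaVal 3 ^ 2
        - 3 / 4 * EulerSum.zetaVal 2 * EulerSum.zetaVal 3 * Real.log 2
        - EulerSum.zetaVal 2 * EulerSum.polylog 4 (1 / 2)
        + 5 / 8 * EulerSum.zetaVal 4 * Real.log 2 ^ 2
        - 1 / 24 * EulerSum.zetaVal 2 * Real.log 2 ^ 4
        + EulerSum.absSum (fun n => EulerSum.altN n 2 / (n : ℝ) ^ 4)
        + EulerSum.absSum (fun n => EulerSum.altN n 3 / (n : ℝ) ^ 3)) ∧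
    -- `∑ L_n(1) ζ_n(3) / n^2`
    EulerSum.absSum (fun n => EulerSum.altN n 1 * EulerSum.zetaN n 3 / (n : ℝ) ^ 2) =
      2079 / 128 * EulerSum.zetaVal 6 + 93 / 32 * EulerSum.zetaVal 5 * Real.log 2
        - 5 / 16 * EulerSum.zetaVal 3 ^ 2
        - 3 * EulerSum.zetaVal 2 * EulerSum.zetaVal 3 * Real.log 2
        - 2 * EulerSum.zetaVal 2 * EulerSum.polylog 4 (1 / 2)
        + 5 / 4 * EulerSum.zetaVal 4 * Real.log 2 ^ 2
        - 1 / 12 * EulerSum.zetaVal 2 * Real.log 2 ^ 4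
        + EulerSum.absSum (fun n => EulerSum.altN n 1 / (n : ℝ) ^ 5 * (-1) ^ (n - 1))
        - EulerSum.absSum (fun n => EulerSum.altN n 2 / (n : ℝ) ^ 4)
        - 4 * EulerSum.absSum (fun n => EulerSum.zetaN n 2 / (n : ℝ) ^ 4 * (-1) ^ (n - 1))
        - 8 * EulerSum.absSum
            (fun n => (harmonic n : ℝ) / (n : ℝ) ^ 5 * (-1) ^ (n - 1)) := by
  have a1 (n : ℕ) : EulerSum.altN n 1 = -EulerSum.nestedSum [-1] n :=
    EulerSum.altN_eq n one_ne_zero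
  have a2 (n : ℕ) : EulerSum.altN n 2 = -EulerSum.nestedSum [-2] n :=
    EulerSum.altN_eq n two_ne_zero
  have a3 (n : ℕ) : EulerSum.altN n 3 = -EulerSum.nestedSum [-3] n :=
    EulerSum.altN_eq n three_ne_zero
  have b2 (n : ℕ) : EulerSum.zetaN n 2 = EulerSum.nestedSum [2] n :=
    EulerSum.zetaN_eq n two_ne_zero
  have b3 (n : ℕ) : EulerSum.zetaN n 3 = EulerSum.nestedSum [3] n :=
    EulerSum.zetaN_eq n three_ne_zero
  have p2 (n : ℕ) : EulerSum.signedTerm 2 (n + 1) = 1 / ((n + 1 : ℕ) : ℝ) ^ 2 :=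
    EulerSum.signedTerm_natCast (k := 2) (by norm_num) n
  have p3 (n : ℕ) : EulerSum.signedTerm 3 (n + 1) = 1 / ((n + 1 : ℕ) : ℝ) ^ 3 :=
    EulerSum.signedTerm_natCast (k := 3) (by norm_num) n
  have p4 (n : ℕ) : EulerSum.signedTerm 4 (n + 1) = 1 / ((n + 1 : ℕ) : ℝ) ^ 4 :=
    EulerSum.signedTerm_natCast (k := 4) (by norm_num) n
  have m1 (n : ℕ) : EulerSum.signedTerm (-1) (n + 1) = -((-1) ^ n / ((n + 1 : ℕ) : ℝ) ^ 1) :=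
    EulerSum.signedTerm_neg_natCast (k := 1) (by norm_num) n
  have m2 (n : ℕ) : EulerSum.signedTerm (-2) (n + 1) = -((-1) ^ n / ((n + 1 : ℕ) : ℝ) ^ 2) :=
    EulerSum.signedTerm_neg_natCast (k := 2) (by norm_num) n
  have m3 (n : ℕ) : EulerSum.signedTerm (-3) (n + 1) = -((-1) ^ n / ((n + 1 : ℕ) : ℝ) ^ 3) :=
    EulerSum.signedTerm_neg_natCast (k := 3) (by norm_num) n
  have m4 (n : ℕ) : EulerSum.signedTerm (-4) (n + 1) = -((-1) ^ n / ((n + 1 : ℕ) : ℝ) ^ 4) :=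
    EulerSum.signedTerm_neg_natCast (k := 4) (by norm_num) n
  have m5 (n : ℕ) : EulerSum.signedTerm (-5) (n + 1) = -((-1) ^ n / ((n + 1 : ℕ) : ℝ) ^ 5) :=
    EulerSum.signedTerm_neg_natCast (k := 5) (by norm_num) n
  have nil (n : ℕ) : EulerSum.nestedSum [] n = 1 := rfl
  -- The scalar `e` is `-1` or `1` according to the parity of the number of factors `L_n(k)` and
  -- `(-1)^(n-1)` in the summand.
  obtain ⟨h1, s1⟩ := EulerSum.absConv_and_absSum_eq 2 [-1] [3] (e := -1)
    (f := fun n => EulerSum.altN n 1 * EulerSum.zetaN n 3 / (n : ℝ) ^ 2) fun n => by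
      simp only [a1, b3, p2]
      ring
  obtain ⟨h2, s2⟩ := EulerSum.absConv_and_absSum_eq 3 [-1] [2] (e := -1)
    (f := fun n => EulerSum.altN n 1 * EulerSum.zetaN n 2 / (n : ℝ) ^ 3) fun n => by
      simp only [a1, b2, p3]
      ring
  obtain ⟨h3, s3⟩ := EulerSum.absConv_and_absSum_eq (-2) [-1] [-3] (e := -1)
    (f := fun n => EulerSum.altN n 1 * EulerSum.altN n 3 / (n : ℝ) ^ 2 * (-1) ^ (n - 1)) fun n => by
      simp only [a1, a3, m2, Nat.add_sub_cancel]
      ring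
  obtain ⟨h4, s4⟩ := EulerSum.absConv_and_absSum_eq (-3) [-1] [-2] (e := -1)
    (f := fun n => EulerSum.altN n 1 * EulerSum.altN n 2 / (n : ℝ) ^ 3 * (-1) ^ (n - 1)) fun n => by
      simp only [a1, a2, m3, Nat.add_sub_cancel]
      ring
  obtain ⟨h5, s5⟩ := EulerSum.absConv_and_absSum_eq (-4) [2] [] (e := -1)
    (f := fun n => EulerSum.zetaN n 2 / (n : ℝ) ^ 4 * (-1) ^ (n - 1)) fun n => by
      simp only [b2, nil, m4, Nat.add_sub_cancel]
      ring
  obtain ⟨h6, s6⟩ := EulerSum.absConv_and_absSum_eq 3 [-3] [] (e := -1)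
    (f := fun n => EulerSum.altN n 3 / (n : ℝ) ^ 3) fun n => by
      simp only [a3, nil, p3]
      ring
  obtain ⟨h7, s7⟩ := EulerSum.absConv_and_absSum_eq 4 [-2] [] (e := -1)
    (f := fun n => EulerSum.altN n 2 / (n : ℝ) ^ 4) fun n => by
      simp only [a2, nil, p4]
      ring
  obtain ⟨h8, s8⟩ := EulerSum.absConv_and_absSum_eq (-5) [-1] [] (e := 1)
    (f := fun n => EulerSum.altN n 1 / (n : ℝ) ^ 5 * (-1) ^ (n - 1)) fun n => by
      simp only [a1, nil, m5, Nat.add_sub_cancel]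
      ring
  obtain ⟨h9, s9⟩ := EulerSum.absConv_and_absSum_eq (-5) [1] [] (e := -1)
    (f := fun n => (harmonic n : ℝ) / (n : ℝ) ^ 5 * (-1) ^ (n - 1)) fun n => by
      simp only [EulerSum.harmonic_eq_nestedSum, nil, m5, Nat.add_sub_cancel]
      ring
  have t1 := EulerSum.SumsTo.of_eq_signedTerm (c := (-1)) (u := [2]) (v := [3]) (e := -1)
    (f := fun n => EulerSum.zetaN n 2 * EulerSum.zetaN n 3 / (n : ℝ) * (-1) ^ (n - 1))
    (fun n => by
      simp only [b2, b3, m1, Nat.add_sub_cancel]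
      ring) (by decide)
  have t2 := EulerSum.SumsTo.of_eq_signedTerm (c := (-1)) (u := [-2]) (v := [-3]) (e := -1)
    (f := fun n => EulerSum.altN n 2 * EulerSum.altN n 3 / (n : ℝ) * (-1) ^ (n - 1))
    (fun n => by
      simp only [a2, a3, m1, Nat.add_sub_cancel]
      ring) (by decide)
  have z2 : EulerSum.mzv [2] = EulerSum.zetaVal 2 :=
    EulerSum.mzv_natCast (k := 2) (by norm_num)
  have z3 : EulerSum.mzv [3] = EulerSum.zetaVal 3 :=
    EulerSum.mzv_natCast (k := 3) (by norm_num)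
  have z4 : EulerSum.mzv [4] = EulerSum.zetaVal 4 :=
    EulerSum.mzv_natCast (k := 4) (by norm_num)
  have z5 : EulerSum.mzv [5] = EulerSum.zetaVal 5 :=
    EulerSum.mzv_natCast (k := 5) (by norm_num)
  have z6 : EulerSum.mzv [6] = EulerSum.zetaVal 6 :=
    EulerSum.mzv_natCast (k := 6) (by norm_num)
  obtain ⟨e1, e2, e3, e4, e5⟩ := EulerSum.eulerSum_weight_six
  simp only [z2, z3, z4, z5, z6, EulerSum.mzv_neg_one] at e1 e2 e3 e4 e5
  refine ⟨⟨h1, h2, h3, h4, h5, h6, h7, h8, h9⟩, ?_, ?_, ?_, ?_, ?_⟩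
  · rw [s1, s2]
    linear_combination e1
  · rw [s5, s6]
    -- Convergence is already known with the Euler sum as limit, so only the equality of the two
    -- limit values remains.
    convert! t1 using 1
    linear_combination -e2
  · rw [s3, s4]
    linear_combination e3
  · rw [s6, s7]
    convert! t2 using 1
    linear_combination -e4
  · rw [s1, s5, s7, s8, s9]
    linear_combination e5
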